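/- \textbf{Setting.} Signals are considered on the time interval $[0,1]$. Write $V_{M}=\operatorname{span}\{e^{2\pi i k t}:\ -M\le k\le M\}$ and, for a function $g$ on $[0,1]$, $\|\mathcal F(g)\|_1=\sum_{k\in\mathbb Z}\bigl|\int_0^1 g(t)e^{-2\pi i k t}\,dt\bigr|$. For a phase function $\vartheta$ put $$L_\vartheta=\frac{\vartheta(1)-\vartheta(0)}{2\pi},\qquad \overline\vartheta=\frac{\vartheta-\vartheta(0)}{2\pi L_\vartheta},\qquad \widehat g_{\vartheta}(\omega)=\int_0^1 g\,e^{-2\pi i\omega\overline\vartheta}\,d\overline\vartheta .$$ \textbf{The iteration.} Let $f$ be a signal and $M_0$ a non-negative integer. From $\theta^m$ one obtains $\theta^{m+1}$ as follows. With $\chi$ the indicator function of $(-\tfrac12,\tfrac12)$ let $$a(t)=\sum_{k\in\mathbb Z}\bigl(\widehat f_{\theta^m}(k+L_{\theta^m})+\widehat f_{\theta^m}(k-L_{\theta^m})\bigr)\chi(k/L_{\theta^m})\,e^{2\pi i k\overline{\theta^m}(t)},$$ $$b(t)=\sum_{k\in\mathbb Z}-i\bigl(\widehat f_{\theta^m}(k+L_{\theta^m})-\widehat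 f_{\theta^m}(k-L_{\theta^m})\bigr)\chi(k/L_{\theta^m})\,e^{2\pi i k\overline{\theta^m}(t)},$$ let $\Delta\theta'=P_{V_{M_0}}\bigl(\tfrac{d}{dt}\arctan(b/a)\bigr)$, where $P_{V_{M_0}}$ is the $L^2(0,1)$-orthogonal projection onto $V_{M_0}$ and $\tfrac{d}{dt}\arctan(b/a)=\frac{ab'-ba'}{a^2+b^2}$ is the derivative of a continuous branch, let $\Delta\theta(t)=\int_0^t\Delta\theta'(s)\,ds$, and let $$\theta^{m+1}=\theta^m+\beta\,\Delta\theta,\qquad \beta=\max\{\alpha\in[0,1]:\ (\theta^m+\alpha\Delta\theta)'\ge 0\ \text{on }[0,1]\}.$$ \textbf{Theorem.} Let $M_0\ge 0$ be an integer, $C_0>0$, $p\ge 4$ real, and let $f_1$ be continuous and positive on $[0,1]$. There is a constant $\Gamma_0>0$, determined by $C_0,p,M_0$ and $f_1$, such that for every normalized phase $\varphi$ there is a constant $\eta_0>4$ (determined by $C_0,p,M_0,f_1$ and $\varphi$) with the following property. Let $$f=f_0+f_1\cos\theta ,$$ where $\theta'\in V_{M_0}$, $\theta'>0$ on $[0,1]$,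 $\overline\theta=\varphi$, the number of periods $L=L_\theta$ is an integer, $f_0$ is continuous on $[0,1]$, and $$|\widehat f_{0,\theta}(k)|\le C_0|k|^{-p},\qquad |\widehat f_{1,\theta}(k)|\le C_0|k|^{-p}\qquad\text{for all integers }k\ne 0 .$$ Let the initial guess $\theta^0$ satisfy $(\theta^0)'\in V_{M_0}$, $L_{\theta^0}\in\mathbb Z$ and $$\|\mathcal F((\theta^0-\theta)')\|_1\le \pi M_0/2 .$$ If $L>\eta_0$, then for every $m\ge 0$ $$\|\mathcal F((\theta^{m+1}-\theta)')\|_1\le \Gamma_0\,(L/4)^{-p+2}+\tfrac12\,\|\mathcal F((\theta^{m}-\theta)')\|_1 .$$ -/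

import Mathlib

open scoped ENNReal

noncomputable section

namespace PhaseRecovery

/-- The Fourier mode `t ↦ exp (2 π i k t)`. -/
def mode (k : ℤ) (t : ℝ) : ℂ :=
  Complex.exp (2 * (Real.pi : ℂ) * Complex.I * (k : ℂ) * (t : ℂ))

/-- `V_M = span {exp (2 π i k t) : -M ≤ k ≤ M}`. -/
def trigSpace (M : ℕ) : Submodule ℂ (ℝ → ℂ) :=
  Submodule.span ℂ (mode '' Set.Icc (-(M : ℤ)) (M : ℤ))

/-- `θ` is differentiable and its instantaneous frequency `θ'` belongs to `V_M`. -/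
def HasFrequencyIn (M : ℕ) (θ : ℝ → ℝ) : Prop :=
  Differentiable ℝ θ ∧ (fun t => ((deriv θ t : ℝ) : ℂ)) ∈ trigSpace M

/-- Fourier coefficients over `[0, 1]` in the physical coordinate `t`. -/
def timeCoeff (g : ℝ → ℝ) (k : ℤ) : ℂ :=
  ∫ t in (0 : ℝ)..1, (g t : ℂ) * mode (-k) t

/-- The `ℓ¹` norm `‖𝓕 g‖₁` of the sequence of Fourier coefficients in the coordinate `t`. -/
def fourierL1 (g : ℝ → ℝ) : ℝ≥0∞ := ∑' k : ℤ, ‖timeCoeff g k‖ₑ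

/-- The number of periods `L_θ = (θ(1) - θ(0)) / (2π)`. -/
def numPeriods (θ : ℝ → ℝ) : ℝ := (θ 1 - θ 0) / (2 * Real.pi)

/-- The normalized phase `θ̄(t) = (θ(t) - θ(0)) / (θ(1) - θ(0))`. -/
def normalizedPhase (θ : ℝ → ℝ) (t : ℝ) : ℝ := (θ t - θ 0) / (θ 1 - θ 0)

/-- The Fourier transform in the `θ`-space, `∫₀¹ f exp (-2 π i ω θ̄) dθ̄`. -/
def phaseCoeff (θ f : ℝ → ℝ) (ω : ℝ) : ℂ :=
  ∫ t in (0 : ℝ)..1,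
    (f t : ℂ) * Complex.exp (-(2 * (Real.pi : ℂ) * Complex.I * (ω : ℂ) * (normalizedPhase θ t : ℂ)))
      * ((deriv (normalizedPhase θ) t : ℝ) : ℂ)

open Classical in
/-- The cutoff function: the indicator function of `(-1/2, 1/2)`. -/
def cutoff (x : ℝ) : ℂ := if -(1 / 2) < x ∧ x < 1 / 2 then 1 else 0

/-- `∑ c(k) χ(k / L_θ) exp (2 π i k θ̄(t))`. Only the integers with `|k| < L_θ / 2` survive the
cutoff, so that for `L_θ > 0` the sum below runs over all integers that contribute. -/
def cutoffSynthesis (θ : ℝ → ℝ) (c : ℤ → ℂ) (t : ℝ) : ℂ :=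
  ∑ k ∈ Finset.Icc (-⌊numPeriods θ⌋) ⌊numPeriods θ⌋,
    c k * cutoff ((k : ℝ) / numPeriods θ) * mode k (normalizedPhase θ t)

/-- The envelope `a`, with `θ`-space coefficients `(f̂_θ(k + L_θ) + f̂_θ(k - L_θ)) χ(k / L_θ)`.
The sum is real, because `f` is real. -/
def envelopeA (θ f : ℝ → ℝ) (t : ℝ) : ℝ :=
  (cutoffSynthesis θ
    (fun k => phaseCoeff θ f ((k : ℝ) + numPeriods θ) + phaseCoeff θ f ((k : ℝ) - numPeriods θ)) t).re

/-- The envelope `b`, with `θ`-space coefficients `-i (f̂_θ(k + L_θ) - f̂_θ(k - L_θ)) χ(k / L_θ)`.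
The sum is real, because `f` is real. -/
def envelopeB (θ f : ℝ → ℝ) (t : ℝ) : ℝ :=
  (cutoffSynthesis θ
    (fun k => -Complex.I *
      (phaseCoeff θ f ((k : ℝ) + numPeriods θ) - phaseCoeff θ f ((k : ℝ) - numPeriods θ))) t).re

/-- `d/dt arctan (b / a)`, in the form that also makes sense where `a` vanishes (the derivative of
a continuous branch of the argument of `a + i b`). -/
def arctanRate (a b : ℝ → ℝ) (t : ℝ) : ℝ :=
  (a t * deriv b t - b t * deriv a t) / (a t ^ 2 + b t ^ 2)

/-- The orthogonal projection onto `V_M` of a real function on `[0, 1]` (a real function again). -/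
def trigProj (M : ℕ) (g : ℝ → ℝ) (t : ℝ) : ℝ :=
  (∑ k ∈ Finset.Icc (-(M : ℤ)) (M : ℤ), timeCoeff g k * mode k t).re

/-- `Δθ' = P_{V_M} (d/dt arctan (b / a))`. -/
def freqIncrement (M : ℕ) (f θ : ℝ → ℝ) : ℝ → ℝ :=
  trigProj M (arctanRate (envelopeA θ f) (envelopeB θ f))

/-- `β = max {α ∈ [0, 1] : (θ + α Δθ)' ≥ 0 on [0, 1]}`. -/
def stepLength (M : ℕ) (f θ : ℝ → ℝ) : ℝ :=
  sSup {α : ℝ | α ∈ Set.Icc (0 : ℝ) 1 ∧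
    ∀ t ∈ Set.Icc (0 : ℝ) 1, 0 ≤ deriv θ t + α * freqIncrement M f θ t}

/-- One step of the algorithm: `θ ↦ θ + β Δθ`, where `Δθ(t) = ∫₀ᵗ Δθ'(s) ds`. -/
def phaseStep (M : ℕ) (f θ : ℝ → ℝ) (t : ℝ) : ℝ :=
  θ t + stepLength M f θ * ∫ s in (0 : ℝ)..t, freqIncrement M f θ s

/-- The phase `θ^m` after `m` steps of the algorithm started at `θ⁰`. -/
def phaseIter (M : ℕ) (f θ₀ : ℝ → ℝ) (m : ℕ) : ℝ → ℝ := (phaseStep M f)^[m] θ₀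

end PhaseRecovery

end

noncomputable section

namespace PhaseRecovery

open MeasureTheory Set

/-! ### Fourier modes -/

/-! Let `ψ` be the current phase, `N = L_ψ`, `σ` its normalization, and `D = (θ - θ(0)) - (ψ -
ψ(0))`. Then `f = f₀ + Re (u exp (2πiNσ))` with `u = f₁ exp (i(θ(0) + D))`. Since `f` is real, `a +
ib` is twice the part of the `σ`-spectrum of `f` in the band of half-width `N/2` around `N`, shifted
to the origin. It would equal `u` if `u` and `f₀` had no `σ`-frequencies `|k| ≥ N/2`, so its error
is a sum of Fourier tails (`norm_analyticEnvelope_sub_le`).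

Decay is assumed in the coordinate `φ = θ̄`, not in `σ`. Each function is therefore split into the
series with the same coefficients read in `σ`, whose tail is `O(L^(-p+2))`, and a remainder whose
derivative is `O(e)`, where `e = ‖𝓕((ψ - θ)')‖₁`. One integration by parts, Parseval and
Cauchy-Schwarz bound the tail of the remainder by `O(L^(-1/4) e)` (`coeffTail_le_of_hasDerivAt`,
`coeffTail_comp_mul_le`). A fixed gain in `L` in front of `e` is all that a contraction needs.

Since `f₁` is bounded below, `arg (a + ib)` differs from `θ(0) + D` by a periodic function of the
same size, up to a constant factor. Its derivative is only seen through the modes `|k| ≤ M₀`, so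
integrating by parts against a mode costs a constant depending on `M₀`
(`norm_timeCoeff_arctanRate_sub_le`). The projection reproduces `D' ∈ V_{M₀}` exactly and the full
step `β = 1` is admissible because `θ'` grows with `L`; only the projected error survives
(`phaseStep_spec`). It is at most `Γ₀ (L/4)^(-p+2) + O(L^(-1/4)) e`, and for large `L` the last
factor is below `1/2`. Integrality of `L_ψ` and the initial bound on `e` persist, so the estimate
iterates. -/

theorem mode_zero_left (t : ℝ) : mode 0 t = 1 := by simp [mode]

theorem mode_zero_right (k : ℤ) : mode k 0 = 1 := by simp [mode]

theorem mode_one_right (k : ℤ) : mode k 1 = 1 := by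
  rw [mode, Complex.exp_eq_one_iff]
  exact ⟨k, by push_cast; ring⟩

theorem mode_add_left (j k : ℤ) (t : ℝ) : mode (j + k) t = mode j t * mode k t := by
  rw [mode, mode, mode, ← Complex.exp_add]
  congr 1; push_cast; ring

theorem mode_eq_exp_ofReal_mul_I (k : ℤ) (t : ℝ) :
    mode k t = Complex.exp (((2 * Real.pi * k * t : ℝ) : ℂ) * Complex.I) := by
  rw [mode]; congr 1; push_cast; ring

theorem norm_mode (k : ℤ) (t : ℝ) : ‖mode k t‖ = 1 := by
  rw [mode_eq_exp_ofReal_mul_I, Complex.norm_exp_ofReal_mul_I]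

theorem conj_mode (k : ℤ) (t : ℝ) : (starRingEnd ℂ) (mode k t) = mode (-k) t := by
  rw [mode, mode, ← Complex.exp_conj]
  congr 1
  simp [Complex.conj_ofNat]

theorem hasDerivAt_mode (k : ℤ) (t : ℝ) :
    HasDerivAt (mode k) (2 * Real.pi * Complex.I * k * mode k t) t := by
  have h : HasDerivAt (fun t : ℝ => 2 * (Real.pi : ℂ) * Complex.I * (k : ℂ) * (t : ℂ))
      (2 * (Real.pi : ℂ) * Complex.I * (k : ℂ)) t := by
    simpa using (Complex.ofRealCLM.hasDerivAt (x := t)).const_mul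
      (2 * (Real.pi : ℂ) * Complex.I * (k : ℂ))
  have h2 := h.cexp
  rw [mul_comm (Complex.exp _)] at h2
  exact h2

theorem continuous_mode (k : ℤ) : Continuous (mode k) :=
  continuous_iff_continuousAt.2 fun t => (hasDerivAt_mode k t).continuousAt

theorem norm_two_pi_I_mul (k : ℤ) : ‖(2 * Real.pi * Complex.I * k : ℂ)‖ = 2 * Real.pi * |(k : ℝ)| := by
  simp [abs_of_pos Real.pi_pos]

theorem norm_mode_sub_le (k : ℤ) (s t : ℝ) :
    ‖mode k s - mode k t‖ ≤ 2 * Real.pi * |(k : ℝ)| * |s - t| := by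
  have := Convex.norm_image_sub_le_of_norm_hasDerivWithin_le (f := mode k) (s := univ)
    (C := 2 * Real.pi * |(k : ℝ)|) (x := t) (y := s)
    (fun x _ => (hasDerivAt_mode k x).hasDerivWithinAt)
    (fun x _ => by rw [norm_mul, norm_mode, norm_two_pi_I_mul, mul_one]) convex_univ trivial trivial
  simpa using this

theorem fourier_coe_eq_mode (k : ℤ) (t : ℝ) : fourier k (t : AddCircle ((1 : ℝ) - 0)) = mode k t := by
  rw [fourier_coe_apply, mode]
  congr 1
  push_cast; ring

/-! ### Fourier coefficients in a curvilinear coordinate -/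

/-- An increasing `C¹` coordinate on `[0, 1]` that fixes both endpoints. -/
structure IsUnitCoordinate (σ : ℝ → ℝ) : Prop where
  differentiable : Differentiable ℝ σ
  continuous_deriv : Continuous (deriv σ)
  deriv_pos : ∀ t ∈ Icc (0 : ℝ) 1, 0 < deriv σ t
  map_zero : σ 0 = 0
  map_one : σ 1 = 1

/-- The Fourier coefficients of `g` with respect to the coordinate `σ` on `[0, 1]`. -/
def coordCoeff (σ : ℝ → ℝ) (g : ℝ → ℂ) (k : ℤ) : ℂ :=
  ∫ t in (0 : ℝ)..1, g t * mode (-k) (σ t) * ((deriv σ t : ℝ) : ℂ)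

variable {σ : ℝ → ℝ}

theorem IsUnitCoordinate.continuous (h : IsUnitCoordinate σ) : Continuous σ :=
  h.differentiable.continuous

theorem IsUnitCoordinate.strictMonoOn (h : IsUnitCoordinate σ) : StrictMonoOn σ (Icc 0 1) :=
  strictMonoOn_of_deriv_pos (convex_Icc 0 1) h.continuous.continuousOn
    fun t ht => h.deriv_pos t (interior_subset ht)

theorem IsUnitCoordinate.mapsTo (h : IsUnitCoordinate σ) : MapsTo σ (Icc 0 1) (Icc 0 1) := by
  intro t ht
  have h0 := h.strictMonoOn.monotoneOn (left_mem_Icc.2 zero_le_one) ht ht.1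
  have h1 := h.strictMonoOn.monotoneOn ht (right_mem_Icc.2 zero_le_one) ht.2
  rw [h.map_zero] at h0; rw [h.map_one] at h1
  exact ⟨h0, h1⟩

/-- The inverse of `σ` on `[0, 1]`, continued by constants outside. It turns a function of `t` into
a function of `s = σ t`, to which the standard Fourier theory on `[0, 1]` applies. -/
theorem IsUnitCoordinate.exists_leftInverse (h : IsUnitCoordinate σ) :
    ∃ γ : ℝ → ℝ, Continuous γ ∧ (∀ s, γ s ∈ Icc (0 : ℝ) 1) ∧ ∀ t ∈ Icc (0 : ℝ) 1, γ (σ t) = t := by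
  let F : Icc (0 : ℝ) 1 → Icc (0 : ℝ) 1 := fun t => ⟨σ t, h.mapsTo t.2⟩
  have hF : StrictMono F := fun s t hst => h.strictMonoOn s.2 t.2 hst
  have hs : Function.Surjective F := by
    rintro ⟨y, hy⟩
    have := intermediate_value_Icc (zero_le_one (α := ℝ)) h.continuous.continuousOn
    rw [h.map_zero, h.map_one] at this
    obtain ⟨t, ht, rfl⟩ := this hy
    exact ⟨⟨t, ht⟩, rfl⟩
  let e := hF.orderIsoOfSurjective F hs
  refine ⟨fun s => e.symm (projIcc 0 1 zero_le_one s),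
    continuous_subtype_val.comp (e.symm.continuous.comp continuous_projIcc), fun s => Subtype.coe_prop _, ?_⟩
  intro t ht
  have : projIcc 0 1 zero_le_one (σ t) = e ⟨t, ht⟩ := projIcc_of_mem _ (h.mapsTo ht)
  show ((e.symm (projIcc 0 1 zero_le_one (σ t)) : Icc (0 : ℝ) 1) : ℝ) = t
  rw [this, OrderIso.symm_apply_apply]

theorem IsUnitCoordinate.integral_comp_mul_deriv {E : Type*} [NormedAddCommGroup E] [NormedSpace ℝ E]
    (h : IsUnitCoordinate σ) {G : ℝ → E} (hG : ContinuousOn G (Icc 0 1)) :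
    ∫ t in (0 : ℝ)..1, deriv σ t • G (σ t) = ∫ s in (0 : ℝ)..1, G s := by
  have h01 : uIcc (0 : ℝ) 1 = Icc 0 1 := uIcc_of_le zero_le_one
  have := intervalIntegral.integral_deriv_smul_comp'' (f := σ) (f' := deriv σ) (g := G) (a := 0) (b := 1)
    h.continuous.continuousOn (fun t _ => (h.differentiable t).hasDerivAt.hasDerivWithinAt)
    h.continuous_deriv.continuousOn
    (hG.mono (by rw [h01]; exact h.mapsTo.image_subset))
  rw [h.map_zero, h.map_one] at this
  exact this

theorem intervalIntegral_congr_Icc {E : Type*} [NormedAddCommGroup E] [NormedSpace ℝ E] {f g : ℝ → E}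
    (h : ∀ t ∈ Icc (0 : ℝ) 1, f t = g t) : ∫ t in (0 : ℝ)..1, f t = ∫ t in (0 : ℝ)..1, g t :=
  intervalIntegral.integral_congr fun t ht => h t (by rwa [uIcc_of_le zero_le_one] at ht)

theorem coordCoeff_congr {g g' : ℝ → ℂ} (h : ∀ t ∈ Icc (0 : ℝ) 1, g t = g' t) (k : ℤ) :
    coordCoeff σ g k = coordCoeff σ g' k :=
  intervalIntegral_congr_Icc fun t ht => by rw [h t ht]

theorem IsUnitCoordinate.continuousOn_integrand (h : IsUnitCoordinate σ) {g : ℝ → ℂ}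
    (hg : ContinuousOn g (Icc 0 1)) (k : ℤ) :
    ContinuousOn (fun t => g t * mode (-k) (σ t) * ((deriv σ t : ℝ) : ℂ)) (Icc 0 1) :=
  (hg.mul ((continuous_mode _).comp h.continuous).continuousOn).mul
    (Complex.continuous_ofReal.comp h.continuous_deriv).continuousOn

theorem intervalIntegrable_of_continuousOn_unit {E : Type*} [NormedAddCommGroup E] {f : ℝ → E}
    (hf : ContinuousOn f (Icc 0 1)) : IntervalIntegrable f volume 0 1 :=
  ContinuousOn.intervalIntegrable (by rwa [uIcc_of_le zero_le_one])

/-- Parseval's identity in the coordinate `σ`. -/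
theorem IsUnitCoordinate.hasSum_sq_coordCoeff (h : IsUnitCoordinate σ) {g : ℝ → ℂ}
    (hg : ContinuousOn g (Icc 0 1)) :
    HasSum (fun k => ‖coordCoeff σ g k‖ ^ 2) (∫ t in (0 : ℝ)..1, deriv σ t * ‖g t‖ ^ 2) := by
  obtain ⟨γ, hγ, hγm, hγi⟩ := h.exists_leftInverse
  have hc : Continuous (fun s => g (γ s)) := hg.comp_continuous hγ hγm
  have hm : MemLp (fun s => g (γ s)) 2 (volume.restrict (Ioc 0 1)) := by
    obtain ⟨C, hC⟩ := isCompact_Icc.exists_bound_of_continuousOn hg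
    exact MemLp.of_bound hc.aestronglyMeasurable C
      (Filter.Eventually.of_forall fun s => hC _ (hγm s))
  have := hasSum_sq_fourierCoeffOn zero_lt_one hm
  convert this using 1
  · funext k
    congr 2
    rw [fourierCoeffOn_eq_integral, coordCoeff]
    simp only [fourier_coe_eq_mode, sub_zero, div_one, one_smul]
    rw [← h.integral_comp_mul_deriv (G := fun s => mode (-k) s • g (γ s))
      ((continuous_mode _).smul hc).continuousOn]
    refine intervalIntegral_congr_Icc fun t ht => ?_
    rw [hγi t ht, Complex.real_smul, smul_eq_mul]; ring
  · simp only [sub_zero, inv_one, one_smul]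
    rw [← h.integral_comp_mul_deriv (G := fun s => ‖g (γ s)‖ ^ 2) (hc.norm.pow 2).continuousOn]
    refine intervalIntegral_congr_Icc fun t ht => ?_
    simp only [hγi t ht, smul_eq_mul]

/-- Parseval makes the weighted `L²` norm vanish, and continuity with `σ' > 0` excludes any nonzero
value, endpoints included. Fourier inversion for summable coefficients follows from this uniqueness.
-/
theorem IsUnitCoordinate.eq_zero_of_coordCoeff_eq_zero (h : IsUnitCoordinate σ) {g : ℝ → ℂ}
    (hg : ContinuousOn g (Icc 0 1)) (h0 : ∀ k, coordCoeff σ g k = 0) :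
    ∀ t ∈ Icc (0 : ℝ) 1, g t = 0 := by
  have hs := h.hasSum_sq_coordCoeff hg
  simp only [h0, norm_zero, ne_eq, OfNat.ofNat_ne_zero, not_false_eq_true, zero_pow] at hs
  have h1 := hs.unique hasSum_zero
  by_contra hne
  push Not at hne
  obtain ⟨t, ht, hgt⟩ := hne
  refine absurd h1 (ne_of_gt ?_)
  refine intervalIntegral.integral_pos zero_lt_one ?_ ?_ ⟨t, ht, ?_⟩
  · exact h.continuous_deriv.continuousOn.mul (hg.norm.pow 2)
  · exact fun s hs => mul_nonneg (h.deriv_pos s (Ioc_subset_Icc_self hs)).le (by positivity)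
  · exact mul_pos (h.deriv_pos t ht) (by positivity)

theorem IsUnitCoordinate.coordCoeff_sub (h : IsUnitCoordinate σ) {g g' : ℝ → ℂ}
    (hg : ContinuousOn g (Icc 0 1)) (hg' : ContinuousOn g' (Icc 0 1)) (k : ℤ) :
    coordCoeff σ (fun t => g t - g' t) k = coordCoeff σ g k - coordCoeff σ g' k := by
  rw [coordCoeff, coordCoeff, coordCoeff, ← intervalIntegral.integral_sub
    (intervalIntegrable_of_continuousOn_unit (h.continuousOn_integrand hg k))
    (intervalIntegrable_of_continuousOn_unit (h.continuousOn_integrand hg' k))]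
  simp only [sub_mul]

theorem IsUnitCoordinate.coordCoeff_add (h : IsUnitCoordinate σ) {g g' : ℝ → ℂ}
    (hg : ContinuousOn g (Icc 0 1)) (hg' : ContinuousOn g' (Icc 0 1)) (k : ℤ) :
    coordCoeff σ (fun t => g t + g' t) k = coordCoeff σ g k + coordCoeff σ g' k := by
  rw [coordCoeff, coordCoeff, coordCoeff, ← intervalIntegral.integral_add
    (intervalIntegrable_of_continuousOn_unit (h.continuousOn_integrand hg k))
    (intervalIntegrable_of_continuousOn_unit (h.continuousOn_integrand hg' k))]
  simp only [add_mul]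

theorem coordCoeff_const_mul (c : ℂ) (g : ℝ → ℂ) (k : ℤ) :
    coordCoeff σ (fun t => c * g t) k = c * coordCoeff σ g k := by
  rw [coordCoeff, coordCoeff, ← intervalIntegral.integral_const_mul]
  simp only [mul_assoc]

theorem coordCoeff_mul_mode (g : ℝ → ℂ) (j k : ℤ) :
    coordCoeff σ (fun t => g t * mode j (σ t)) k = coordCoeff σ g (k - j) := by
  rw [coordCoeff, coordCoeff]
  congr 1; funext t
  rw [mul_assoc (g t), ← mode_add_left, show j + -k = -(k - j) by ring]

theorem coordCoeff_conj (g : ℝ → ℂ) (k : ℤ) :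
    coordCoeff σ (fun t => (starRingEnd ℂ) (g t)) k = (starRingEnd ℂ) (coordCoeff σ g (-k)) := by
  rw [coordCoeff, coordCoeff, ← intervalIntegral.intervalIntegral_conj]
  congr 1; funext t
  simp [conj_mode]

/-- Integration by parts in the coordinate `σ`. -/
theorem IsUnitCoordinate.coordCoeff_of_hasDerivAt (h : IsUnitCoordinate σ) {g g' : ℝ → ℂ}
    (hg : ∀ t, HasDerivAt g (g' t) t) (hg' : Continuous g') (hper : g 0 = g 1) (k : ℤ) :
    2 * Real.pi * Complex.I * k * coordCoeff σ g k
      = coordCoeff σ (fun t => g' t / ((deriv σ t : ℝ) : ℂ)) k := by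
  have hd : ∀ t, HasDerivAt (fun t => mode (-k) (σ t))
      (-(2 * Real.pi * Complex.I * k) * mode (-k) (σ t) * ((deriv σ t : ℝ) : ℂ)) t := by
    intro t
    have := (hasDerivAt_mode (-k) (σ t)).scomp t (h.differentiable t).hasDerivAt
    rw [Complex.real_smul] at this
    refine this.congr_deriv ?_
    push_cast; ring
  have hm : Continuous fun t => mode (-k) (σ t) := (continuous_mode _).comp h.continuous
  have hds : Continuous fun t => ((deriv σ t : ℝ) : ℂ) :=
    Complex.continuous_ofReal.comp h.continuous_deriv
  have key := intervalIntegral.integral_mul_deriv_eq_deriv_mul (a := 0) (b := 1)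
    (fun t _ => hg t) (fun t _ => hd t) (hg'.intervalIntegrable _ _)
    (((continuous_const.mul hm).mul hds).intervalIntegrable _ _)
  rw [h.map_zero, h.map_one, mode_zero_right, mode_one_right, hper, sub_self, zero_sub] at key
  have e1 : (∫ t in (0 : ℝ)..1, g t * (-(2 * Real.pi * Complex.I * k) * mode (-k) (σ t) *
      ((deriv σ t : ℝ) : ℂ))) = -(2 * Real.pi * Complex.I * k) * coordCoeff σ g k := by
    rw [coordCoeff, ← intervalIntegral.integral_const_mul]
    congr 1; funext t; ring
  have e2 : (∫ t in (0 : ℝ)..1, g' t * mode (-k) (σ t))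
      = coordCoeff σ (fun t => g' t / ((deriv σ t : ℝ) : ℂ)) k := by
    refine intervalIntegral_congr_Icc fun t ht => ?_
    have : ((deriv σ t : ℝ) : ℂ) ≠ 0 := by exact_mod_cast (h.deriv_pos t ht).ne'
    field_simp
  rw [e1, e2] at key
  linear_combination -key

theorem IsUnitCoordinate.coordCoeff_mode (h : IsUnitCoordinate σ) (j k : ℤ) :
    coordCoeff σ (fun t => mode j (σ t)) k = if k = j then 1 else 0 := by
  have h1 : coordCoeff σ (fun t => mode j (σ t)) k = ∫ s in (0 : ℝ)..1, mode (j - k) s := by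
    rw [coordCoeff, ← h.integral_comp_mul_deriv (continuous_mode _).continuousOn]
    congr 1; funext t
    rw [← mode_add_left, Complex.real_smul, sub_eq_add_neg, mul_comm]
  rw [h1]
  split_ifs with hkj
  · simp [hkj, mode_zero_left]
  · have hne : (2 * Real.pi * Complex.I * ((j - k : ℤ) : ℂ)) ≠ 0 := by
      have : j - k ≠ 0 := fun h => hkj (by omega)
      simp only [ne_eq, mul_eq_zero, not_or]
      refine ⟨⟨⟨two_ne_zero, by exact_mod_cast Real.pi_ne_zero⟩, Complex.I_ne_zero⟩, by exact_mod_cast this⟩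
    have := intervalIntegral.integral_eq_sub_of_hasDerivAt (a := 0) (b := 1)
      (fun t _ => hasDerivAt_mode (j - k) t)
      ((continuous_const.mul (continuous_mode _)).intervalIntegrable _ _)
    rw [mode_one_right, mode_zero_right, sub_self, intervalIntegral.integral_const_mul] at this
    exact (mul_eq_zero.1 this).resolve_left hne

/-- An absolutely convergent trigonometric series. -/
def trigSeries (c : ℤ → ℂ) (s : ℝ) : ℂ := ∑' k, c k * mode k s

theorem summable_mul_mode {c : ℤ → ℂ} (hc : Summable fun k => ‖c k‖) (s : ℝ) :
    Summable fun k => c k * mode k s :=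
  Summable.of_norm (by simpa [norm_mode] using hc)

theorem continuous_trigSeries {c : ℤ → ℂ} (hc : Summable fun k => ‖c k‖) : Continuous (trigSeries c) :=
  continuous_tsum (fun k => continuous_const.mul (continuous_mode k)) hc
    fun k s => by rw [norm_mul, norm_mode, mul_one]

theorem IsUnitCoordinate.coordCoeff_trigSeries (h : IsUnitCoordinate σ) {c : ℤ → ℂ}
    (hc : Summable fun k => ‖c k‖) (k : ℤ) :
    coordCoeff σ (fun t => trigSeries c (σ t)) k = c k := by
  have hs := intervalIntegral.hasSum_integral_of_dominated_convergence (μ := volume) (a := 0) (b := 1)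
    (F := fun j t => c j * mode j (σ t) * mode (-k) (σ t) * ((deriv σ t : ℝ) : ℂ))
    (f := fun t => trigSeries c (σ t) * mode (-k) (σ t) * ((deriv σ t : ℝ) : ℂ))
    (fun j t => ‖c j‖ * |deriv σ t|)
    (fun j => (((continuous_const.mul ((continuous_mode j).comp h.continuous)).mul
      ((continuous_mode _).comp h.continuous)).mul
      (Complex.continuous_ofReal.comp h.continuous_deriv)).aestronglyMeasurable)
    (fun j => Filter.Eventually.of_forall fun t _ => by simp [norm_mode])
    (Filter.Eventually.of_forall fun t _ => hc.mul_right _)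
    (by
      simp only [tsum_mul_right]
      exact (continuous_const.mul h.continuous_deriv.abs).intervalIntegrable _ _)
    (Filter.Eventually.of_forall fun t _ =>
      (((summable_mul_mode hc (σ t)).hasSum).mul_right _).mul_right _)
  have e : ∀ j, (∫ t in (0 : ℝ)..1, c j * mode j (σ t) * mode (-k) (σ t) * ((deriv σ t : ℝ) : ℂ))
      = if k = j then c j else 0 := by
    intro j
    have := coordCoeff_const_mul (σ := σ) (c j) (fun t => mode j (σ t)) k
    rw [h.coordCoeff_mode, coordCoeff] at this
    rw [this]; simp
  simp only [e] at hs
  have h2 := hasSum_ite_eq k (c k)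
  refine hs.unique ?_
  have e2 : (fun j => if j = k then c k else 0) = fun j => if k = j then c j else 0 := by
    funext j
    by_cases hj : j = k
    · simp [hj]
    · simp [hj, Ne.symm hj]
  rwa [e2] at h2

/-- Fourier inversion in the coordinate `σ`. -/
theorem IsUnitCoordinate.eq_trigSeries (h : IsUnitCoordinate σ) {g : ℝ → ℂ}
    (hg : ContinuousOn g (Icc 0 1)) (hs : Summable fun k => ‖coordCoeff σ g k‖) :
    ∀ t ∈ Icc (0 : ℝ) 1, g t = trigSeries (coordCoeff σ g) (σ t) := by
  have hc : ContinuousOn (fun t => trigSeries (coordCoeff σ g) (σ t)) (Icc 0 1) :=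
    ((continuous_trigSeries hs).comp h.continuous).continuousOn
  have := h.eq_zero_of_coordCoeff_eq_zero (hg.sub hc) fun k => by
    rw [show (g - fun t => trigSeries (coordCoeff σ g) (σ t))
      = fun t => g t - trigSeries (coordCoeff σ g) (σ t) from rfl, h.coordCoeff_sub hg hc, h.coordCoeff_trigSeries hs, sub_self]
  exact fun t ht => sub_eq_zero.1 (this t ht)

/-! ### Trigonometric series with decaying coefficients -/

theorem norm_trigSeries_le {c : ℤ → ℂ} (hc : Summable fun k => ‖c k‖) (s : ℝ) :
    ‖trigSeries c s‖ ≤ ∑' k, ‖c k‖ := by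
  refine (norm_tsum_le_tsum_norm ?_).trans_eq ?_
  · simpa [norm_mode] using hc
  · simp [norm_mode]

theorem norm_trigSeries_sub_le {c : ℤ → ℂ} (hc : Summable fun k => ‖c k‖)
    (hc1 : Summable fun k : ℤ => 2 * Real.pi * |(k : ℝ)| * ‖c k‖) (s t : ℝ) :
    ‖trigSeries c s - trigSeries c t‖ ≤ (∑' k : ℤ, 2 * Real.pi * |(k : ℝ)| * ‖c k‖) * |s - t| := by
  rw [trigSeries, trigSeries, ← (summable_mul_mode hc s).tsum_sub (summable_mul_mode hc t),
    ← tsum_mul_right]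
  refine tsum_of_norm_bounded (hc1.mul_right _).hasSum fun k => ?_
  rw [← mul_sub, norm_mul]
  calc ‖c k‖ * ‖mode k s - mode k t‖ ≤ ‖c k‖ * (2 * Real.pi * |(k : ℝ)| * |s - t|) := by
        gcongr; exact norm_mode_sub_le k s t
    _ = _ := by ring

theorem hasDerivAt_trigSeries {c : ℤ → ℂ} (hc : Summable fun k => ‖c k‖)
    (hc1 : Summable fun k : ℤ => 2 * Real.pi * |(k : ℝ)| * ‖c k‖) (s : ℝ) :
    HasDerivAt (trigSeries c) (trigSeries (fun k => 2 * Real.pi * Complex.I * k * c k) s) s := by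
  have := hasDerivAt_tsum (g := fun k s => c k * mode k s)
    (g' := fun k s => 2 * Real.pi * Complex.I * k * c k * mode k s) (y₀ := 0) hc1
    (fun k y => by
      exact ((hasDerivAt_mode k y).const_mul (c k)).congr_deriv (by ring))
    (fun k y => by rw [norm_mul, norm_mode, mul_one, norm_mul, norm_two_pi_I_mul])
    (summable_mul_mode hc 0) s
  exact this

/-- The constant `∑ |k|⁻²`, summed over the nonzero integers. -/
def invSqSum : ℝ := ∑' k : ℤ, |(k : ℝ)| ^ (-2 : ℝ)

/-- The term `k = 0` is harmless because `0 ^ (-2 : ℝ) = 0`; the same convention removes the zero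
mode from all weighted sums below. -/
theorem summable_invSq : Summable fun k : ℤ => |(k : ℝ)| ^ (-2 : ℝ) :=
  Real.summable_abs_int_rpow (by norm_num)

theorem invSqSum_nonneg : 0 ≤ invSqSum := tsum_nonneg fun _ => by positivity

theorem one_le_abs_intCast {k : ℤ} (hk : k ≠ 0) : 1 ≤ |(k : ℝ)| := by
  exact_mod_cast Int.one_le_abs hk

/-- The coefficients `c k`, `k ≠ 0`, decay like `C |k| ^ (-p)`. -/
def HasPowerDecay (c : ℤ → ℂ) (C p : ℝ) : Prop := ∀ k : ℤ, k ≠ 0 → ‖c k‖ ≤ C * |(k : ℝ)| ^ (-p)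

variable {c : ℤ → ℂ} {C₀ p : ℝ}

theorem HasPowerDecay.sq_mul_norm_le (h : HasPowerDecay c C₀ p) (hC : 0 ≤ C₀) (hp : 4 ≤ p) (k : ℤ) :
    |(k : ℝ)| ^ 2 * ‖c k‖ ≤ C₀ * |(k : ℝ)| ^ (-2 : ℝ) := by
  rcases eq_or_ne k 0 with rfl | hk
  · simp
  have h1 := one_le_abs_intCast hk
  calc |(k : ℝ)| ^ 2 * ‖c k‖ ≤ |(k : ℝ)| ^ 2 * (C₀ * |(k : ℝ)| ^ (-p)) := by gcongr; exact h k hk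
    _ ≤ |(k : ℝ)| ^ 2 * (C₀ * |(k : ℝ)| ^ (-4 : ℝ)) := by gcongr
    _ = C₀ * (|(k : ℝ)| ^ (2 : ℝ) * |(k : ℝ)| ^ (-4 : ℝ)) := by rw [Real.rpow_two]; ring
    _ = _ := by rw [← Real.rpow_add (by linarith)]; norm_num

theorem HasPowerDecay.summable_sq (h : HasPowerDecay c C₀ p) (hC : 0 ≤ C₀) (hp : 4 ≤ p) :
    Summable fun k : ℤ => |(k : ℝ)| ^ 2 * ‖c k‖ :=
  Summable.of_nonneg_of_le (fun _ => by positivity) (h.sq_mul_norm_le hC hp)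
    (summable_invSq.mul_left C₀)

theorem HasPowerDecay.tsum_sq_le (h : HasPowerDecay c C₀ p) (hC : 0 ≤ C₀) (hp : 4 ≤ p) :
    ∑' k : ℤ, |(k : ℝ)| ^ 2 * ‖c k‖ ≤ C₀ * invSqSum := by
  rw [invSqSum, ← tsum_mul_left]
  exact (h.summable_sq hC hp).tsum_le_tsum (h.sq_mul_norm_le hC hp) (summable_invSq.mul_left C₀)

theorem abs_mul_norm_le_sq (c : ℤ → ℂ) (k : ℤ) : |(k : ℝ)| * ‖c k‖ ≤ |(k : ℝ)| ^ 2 * ‖c k‖ := by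
  rcases eq_or_ne k 0 with rfl | hk
  · simp
  have h1 := one_le_abs_intCast hk
  gcongr
  nlinarith

theorem HasPowerDecay.summable_abs_mul (h : HasPowerDecay c C₀ p) (hC : 0 ≤ C₀) (hp : 4 ≤ p) :
    Summable fun k : ℤ => |(k : ℝ)| * ‖c k‖ :=
  Summable.of_nonneg_of_le (fun _ => by positivity) (abs_mul_norm_le_sq c) (h.summable_sq hC hp)

theorem summable_norm_of_le_of_ne_zero {b : ℤ → ℝ} (hb : Summable b)
    (h : ∀ k : ℤ, k ≠ 0 → ‖c k‖ ≤ b k) : Summable fun k => ‖c k‖ := by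
  refine Summable.of_norm_bounded_eventually hb ?_
  refine ((Set.finite_singleton (0 : ℤ)).subset fun _ hk => ?_)
  by_contra hne
  exact hk (by simpa using h _ hne)

theorem HasPowerDecay.summable_norm (h : HasPowerDecay c C₀ p) (hC : 0 ≤ C₀) (hp : 4 ≤ p) :
    Summable fun k : ℤ => ‖c k‖ :=
  summable_norm_of_le_of_ne_zero (h.summable_abs_mul hC hp) fun _ hk =>
    le_mul_of_one_le_left (norm_nonneg _) (one_le_abs_intCast hk)

/-- A bound for the first derivative of a trigonometric series, and for its Lipschitz constant. -/
def derivBound (C₀ : ℝ) : ℝ := 4 * Real.pi ^ 2 * (C₀ * invSqSum)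

theorem derivBound_nonneg (hC : 0 ≤ C₀) : 0 ≤ derivBound C₀ := by
  have := invSqSum_nonneg
  unfold derivBound; positivity

theorem HasPowerDecay.norm_deriv_le (h : HasPowerDecay c C₀ p) (hC : 0 ≤ C₀) (hp : 4 ≤ p) (s : ℝ) :
    ‖trigSeries (fun k => 2 * Real.pi * Complex.I * k * c k) s‖ ≤ derivBound C₀ := by
  have hs : Summable fun k : ℤ => ‖2 * Real.pi * Complex.I * k * c k‖ := by
    refine (((h.summable_abs_mul hC hp).mul_left (2 * Real.pi))).congr fun k => ?_
    rw [norm_mul, norm_two_pi_I_mul, mul_assoc (2 * Real.pi)]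
  refine (norm_trigSeries_le hs s).trans ?_
  refine (hs.tsum_le_tsum (g := fun k : ℤ => 4 * Real.pi ^ 2 * (|(k : ℝ)| ^ 2 * ‖c k‖)) (fun k => ?_)
    ((h.summable_sq hC hp).mul_left _)).trans ?_
  · rw [norm_mul, norm_two_pi_I_mul, mul_assoc]
    have := abs_mul_norm_le_sq c k
    have hpi := Real.pi_gt_three
    have h0 : 0 ≤ |(k : ℝ)| * ‖c k‖ := by positivity
    calc 2 * Real.pi * (|(k : ℝ)| * ‖c k‖) ≤ 4 * Real.pi ^ 2 * (|(k : ℝ)| * ‖c k‖) := by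
          refine mul_le_mul_of_nonneg_right ?_ h0; nlinarith
      _ ≤ _ := by gcongr
  · rw [tsum_mul_left, derivBound]
    gcongr
    exact h.tsum_sq_le hC hp

theorem HasPowerDecay.norm_deriv_sub_le (h : HasPowerDecay c C₀ p) (hC : 0 ≤ C₀) (hp : 4 ≤ p)
    (s t : ℝ) :
    ‖trigSeries (fun k => 2 * Real.pi * Complex.I * k * c k) s
      - trigSeries (fun k => 2 * Real.pi * Complex.I * k * c k) t‖ ≤ derivBound C₀ * |s - t| := by
  have hs : Summable fun k : ℤ => ‖2 * Real.pi * Complex.I * k * c k‖ := by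
    refine (((h.summable_abs_mul hC hp).mul_left (2 * Real.pi))).congr fun k => ?_
    rw [norm_mul, norm_two_pi_I_mul, mul_assoc (2 * Real.pi)]
  have e : (fun k : ℤ => 2 * Real.pi * |(k : ℝ)| * ‖2 * Real.pi * Complex.I * k * c k‖)
      = fun k : ℤ => 4 * Real.pi ^ 2 * (|(k : ℝ)| ^ 2 * ‖c k‖) := by
    funext k
    rw [norm_mul _ (c k), norm_two_pi_I_mul]; ring
  refine (norm_trigSeries_sub_le hs (by rw [e]; exact (h.summable_sq hC hp).mul_left _) s t).trans ?_
  rw [e, tsum_mul_left, derivBound]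
  gcongr
  exact h.tsum_sq_le hC hp

theorem HasPowerDecay.hasDerivAt_trigSeries (h : HasPowerDecay c C₀ p) (hC : 0 ≤ C₀) (hp : 4 ≤ p)
    (s : ℝ) :
    HasDerivAt (trigSeries c) (trigSeries (fun k => 2 * Real.pi * Complex.I * k * c k) s) s :=
  PhaseRecovery.hasDerivAt_trigSeries (h.summable_norm hC hp)
    (by simp only [mul_assoc]; exact ((h.summable_abs_mul hC hp).mul_left _).mul_left _) s

/-! ### Tails of the Fourier coefficients -/

/-- The `ℓ¹` norm of the part of a sequence with indices `|k| ≥ K`. -/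
def coeffTail (c : ℤ → ℂ) (K : ℝ) : ℝ := ∑' k : ℤ, {k : ℤ | K ≤ |(k : ℝ)|}.indicator (fun k => ‖c k‖) k

theorem coeffTail_le_of_le {b : ℤ → ℝ} {K : ℝ} (hb : Summable b) (hb0 : ∀ k, 0 ≤ b k)
    (h : ∀ k : ℤ, K ≤ |(k : ℝ)| → ‖c k‖ ≤ b k) : coeffTail c K ≤ ∑' k, b k := by
  have hle : ∀ k, {k : ℤ | K ≤ |(k : ℝ)|}.indicator (fun k => ‖c k‖) k ≤ b k := fun k =>
    indicator_le' (fun k hk => h k hk) (fun k _ => hb0 k) k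
  exact (Summable.of_nonneg_of_le (fun k => indicator_nonneg (fun _ _ => norm_nonneg _) k) hle hb).tsum_le_tsum
    hle hb

theorem coeffTail_add_le {d : ℤ → ℂ} (hc : Summable fun k => ‖c k‖) (hd : Summable fun k => ‖d k‖)
    (K : ℝ) : coeffTail (fun k => c k + d k) K ≤ coeffTail c K + coeffTail d K := by
  have h1 := hc.indicator {k : ℤ | K ≤ |(k : ℝ)|}
  have h2 := hd.indicator {k : ℤ | K ≤ |(k : ℝ)|}
  rw [coeffTail.eq_def c, coeffTail.eq_def d, ← h1.tsum_add h2]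
  refine coeffTail_le_of_le (h1.add h2)
    (fun k => add_nonneg (indicator_nonneg (fun _ _ => norm_nonneg _) k)
      (indicator_nonneg (fun _ _ => norm_nonneg _) k)) fun k hk => ?_
  have hk' : k ∈ {k : ℤ | K ≤ |(k : ℝ)|} := hk
  rw [indicator_of_mem hk', indicator_of_mem hk']
  exact norm_add_le _ _

/-- Used for the shifted indices `k + N` and `-(k + 2N)` produced by demodulation. -/
theorem sum_norm_le_coeffTail (hc : Summable fun k => ‖c k‖) {K : ℝ} {ι : Type*} (s : Finset ι)
    (j : ι → ℤ) (hj : Set.InjOn j s) (hK : ∀ i ∈ s, K ≤ |(j i : ℝ)|) :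
    ∑ i ∈ s, ‖c (j i)‖ ≤ coeffTail c K := by
  classical
  have h1 := hc.indicator {k : ℤ | K ≤ |(k : ℝ)|}
  rw [← Finset.sum_image (f := fun k => ‖c k‖) hj]
  refine le_trans (le_of_eq ?_) (h1.sum_le_tsum (s.image j)
    fun k _ => indicator_nonneg (fun _ _ => norm_nonneg _) k)
  refine Finset.sum_congr rfl fun k hk => ?_
  obtain ⟨i, hi, rfl⟩ := Finset.mem_image.1 hk
  rw [indicator_of_mem (show j i ∈ {k : ℤ | K ≤ |(k : ℝ)|} from hK i hi)]

/-- Write `|k|^(-p) = |k|^(-p+2) |k|^(-2)`: the first factor is at most `K^(-p+2)` on the tail and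
the second is summable. This is the origin of the exponent `-p + 2`. -/
theorem HasPowerDecay.coeffTail_le (h : HasPowerDecay c C₀ p) (hC : 0 ≤ C₀) (hp : 2 ≤ p) {K : ℝ}
    (hK : 0 < K) : coeffTail c K ≤ C₀ * invSqSum * K ^ (-p + 2) := by
  rw [show C₀ * invSqSum * K ^ (-p + 2) = ∑' k : ℤ, C₀ * K ^ (-p + 2) * |(k : ℝ)| ^ (-2 : ℝ) by
    rw [tsum_mul_left, invSqSum]; ring]
  refine coeffTail_le_of_le (summable_invSq.mul_left _) (fun k => by positivity) fun k hk => ?_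
  have hk0 : 0 < |(k : ℝ)| := hK.trans_le hk
  refine (h k (by rintro rfl; simp at hk0)).trans ?_
  rw [mul_assoc, show -p = (-p + 2) + -2 by ring, Real.rpow_add hk0, show -p + 2 + -2 + 2 = -p + 2 by ring]
  gcongr C₀ * (?_ * _)
  exact Real.rpow_le_rpow_of_nonpos hK hk (by linarith)

/-- The constant `(∑ |k| ^ (-3/2)) ^ (1/2)`, summed over the nonzero integers. -/
def invSqrtConst : ℝ := (∑' k : ℤ, |(k : ℝ)| ^ (-(3 / 2) : ℝ)) ^ (1 / 2 : ℝ)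

theorem invSqrtConst_nonneg : 0 ≤ invSqrtConst :=
  Real.rpow_nonneg (tsum_nonneg fun _ => by positivity) _

theorem IsUnitCoordinate.integral_deriv (h : IsUnitCoordinate σ) : ∫ t in (0 : ℝ)..1, deriv σ t = 1 := by
  rw [intervalIntegral.integral_deriv_eq_sub (fun t _ => h.differentiable t)
    (h.continuous_deriv.intervalIntegrable _ _), h.map_zero, h.map_one, sub_zero]

theorem IsUnitCoordinate.tsum_sq_coordCoeff_le (h : IsUnitCoordinate σ) {g : ℝ → ℂ}
    (hg : ContinuousOn g (Icc 0 1)) {W : ℝ} (hW : ∀ t ∈ Icc (0 : ℝ) 1, ‖g t‖ ≤ W) :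
    ∑' k, ‖coordCoeff σ g k‖ ^ 2 ≤ W ^ 2 := by
  rw [(h.hasSum_sq_coordCoeff hg).tsum_eq]
  calc ∫ t in (0 : ℝ)..1, deriv σ t * ‖g t‖ ^ 2 ≤ ∫ t in (0 : ℝ)..1, deriv σ t * W ^ 2 := by
        refine intervalIntegral.integral_mono_on zero_le_one
          (intervalIntegrable_of_continuousOn_unit
            (h.continuous_deriv.continuousOn.mul (hg.norm.pow 2)))
          ((h.continuous_deriv.mul continuous_const).intervalIntegrable _ _) fun t ht => ?_
        have := (h.deriv_pos t ht).le
        have := hW t ht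
        gcongr
    _ = W ^ 2 := by rw [intervalIntegral.integral_mul_const, h.integral_deriv, one_mul]

/-- Cauchy-Schwarz and Parseval: the coefficients of a bounded function, weighted by
`|k| ^ (-3/4)`, are summable. -/
theorem IsUnitCoordinate.summable_weighted_coordCoeff (h : IsUnitCoordinate σ) {g : ℝ → ℂ}
    (hg : ContinuousOn g (Icc 0 1)) {W : ℝ} (hW0 : 0 ≤ W) (hW : ∀ t ∈ Icc (0 : ℝ) 1, ‖g t‖ ≤ W) :
    (Summable fun k : ℤ => ‖coordCoeff σ g k‖ * |(k : ℝ)| ^ (-(3 / 4) : ℝ)) ∧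
      ∑' k : ℤ, ‖coordCoeff σ g k‖ * |(k : ℝ)| ^ (-(3 / 4) : ℝ) ≤ W * invSqrtConst := by
  have e : ∀ k : ℤ, (|(k : ℝ)| ^ (-(3 / 4) : ℝ)) ^ (2 : ℝ) = |(k : ℝ)| ^ (-(3 / 2) : ℝ) := by
    intro k
    rw [← Real.rpow_mul (abs_nonneg _)]; norm_num
  have hs := (h.hasSum_sq_coordCoeff hg).summable
  have := Real.summable_and_inner_le_Lp_mul_Lq_tsum_of_nonneg (p := 2) (q := 2)
    (f := fun k : ℤ => ‖coordCoeff σ g k‖) (g := fun k : ℤ => |(k : ℝ)| ^ (-(3 / 4) : ℝ))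
    (by constructor <;> norm_num) (fun _ => norm_nonneg _) (fun _ => by positivity)
    (by simpa only [Real.rpow_two] using hs)
    (by simp only [e]; exact Real.summable_abs_int_rpow (by norm_num))
  refine ⟨this.1, this.2.trans ?_⟩
  simp only [e, Real.rpow_two]
  rw [invSqrtConst]
  gcongr
  · rw [← Real.sqrt_eq_rpow]
    exact Real.sqrt_le_iff.2 ⟨hW0, h.tsum_sq_coordCoeff_le hg hW⟩

/-- Integration by parts gains `|k|⁻¹` over the coefficients of `g' / σ'`, which are square summable
with norm at most `W`. Only one derivative of `g` is needed, and the bound is linear in `W`. -/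
theorem IsUnitCoordinate.coeffTail_le_of_hasDerivAt (h : IsUnitCoordinate σ) {g g' : ℝ → ℂ}
    (hg : ∀ t, HasDerivAt g (g' t) t) (hg' : Continuous g') (hper : g 0 = g 1) {W : ℝ} (hW0 : 0 ≤ W)
    (hW : ∀ t ∈ Icc (0 : ℝ) 1, ‖g' t‖ ≤ W * deriv σ t) :
    (Summable fun k => ‖coordCoeff σ g k‖) ∧ ∀ K : ℝ, 0 < K →
      coeffTail (coordCoeff σ g) K ≤ K ^ (-(1 / 4) : ℝ) * (W * invSqrtConst) := by
  set q : ℝ → ℂ := fun t => g' t / ((deriv σ t : ℝ) : ℂ) with hq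
  have hqc : ContinuousOn q (Icc 0 1) :=
    hg'.continuousOn.div (Complex.continuous_ofReal.comp h.continuous_deriv).continuousOn
      fun t ht => by exact_mod_cast (h.deriv_pos t ht).ne'
  have hqW : ∀ t ∈ Icc (0 : ℝ) 1, ‖q t‖ ≤ W := by
    intro t ht
    have hp := h.deriv_pos t ht
    rw [hq]
    simp only [norm_div, Complex.norm_real, Real.norm_eq_abs, abs_of_pos hp]
    exact (div_le_iff₀ hp).2 (hW t ht)
  obtain ⟨hs, hle⟩ := h.summable_weighted_coordCoeff hqc hW0 hqW
  have hk : ∀ k : ℤ, k ≠ 0 → ‖coordCoeff σ g k‖ ≤ ‖coordCoeff σ q k‖ * |(k : ℝ)|⁻¹ := by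
    intro k hk
    have h1 := one_le_abs_intCast hk
    have h2 := congrArg norm (h.coordCoeff_of_hasDerivAt hg hg' hper k)
    rw [norm_mul, norm_two_pi_I_mul] at h2
    rw [← h2, ← div_eq_mul_inv, le_div_iff₀ (by linarith)]
    have hpi := Real.pi_gt_three
    have h3 : 0 ≤ |(k : ℝ)| * ‖coordCoeff σ g k‖ := by positivity
    nlinarith
  -- The weight `|k|^(-3/4)` is still square summable and pays for Cauchy-Schwarz; the spare
  -- `|k|^(-1/4)` makes the tail small.
  have hk2 : ∀ k : ℤ, k ≠ 0 → |(k : ℝ)|⁻¹ = |(k : ℝ)| ^ (-(1 / 4) : ℝ) * |(k : ℝ)| ^ (-(3 / 4) : ℝ) := by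
    intro k hk
    rw [← Real.rpow_add (by linarith [one_le_abs_intCast hk]), ← Real.rpow_neg_one]; norm_num
  refine ⟨summable_norm_of_le_of_ne_zero hs fun k h0 => (hk k h0).trans ?_, fun K hK => ?_⟩
  · rw [hk2 k h0]
    gcongr
    exact mul_le_of_le_one_left (by positivity)
      (Real.rpow_le_one_of_one_le_of_nonpos (one_le_abs_intCast h0) (by norm_num))
  · refine le_trans ?_ (mul_le_mul_of_nonneg_left hle (by positivity))
    rw [← tsum_mul_left]
    refine coeffTail_le_of_le (hs.mul_left _) (fun k => by positivity) fun k hkK => ?_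
    have h0 : k ≠ 0 := by rintro rfl; simp at hkK; linarith
    refine (hk k h0).trans ?_
    rw [hk2 k h0, mul_left_comm]
    gcongr ?_ * _
    exact Real.rpow_le_rpow_of_nonpos hK hkK (by norm_num)

variable {φ : ℝ → ℝ}

/-- Tail estimate for the coefficients, in the coordinate `σ`, of a function whose coefficients decay
in a nearby coordinate `φ`, after modulation by a factor `U` close to `1`. -/
theorem HasPowerDecay.coeffTail_comp_mul_le (hc : HasPowerDecay c C₀ p) (hC₀ : 0 ≤ C₀) (hp : 4 ≤ p)
    (hσ : IsUnitCoordinate σ) (hφ : IsUnitCoordinate φ) {U U' : ℝ → ℂ}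
    (hU : ∀ t, HasDerivAt U (U' t) t) (hU' : Continuous U') (hU0 : U 0 = 1) (hU1 : U 1 = 1)
    {e m C B C₁ : ℝ} (he : 0 ≤ e) (hm : 0 < m) (hC : 0 ≤ C) (hB : 0 ≤ B) (hC₁ : 0 ≤ C₁)
    (hσm : ∀ t ∈ Icc (0 : ℝ) 1, m ≤ deriv σ t) (hφC : ∀ t ∈ Icc (0 : ℝ) 1, deriv φ t ≤ C)
    (hUe : ∀ t ∈ Icc (0 : ℝ) 1, ‖U t - 1‖ ≤ e)
    (hUB : ∀ t ∈ Icc (0 : ℝ) 1, ‖trigSeries c (φ t)‖ * ‖U' t‖ ≤ B * e)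
    (hφσ : ∀ t ∈ Icc (0 : ℝ) 1, |φ t - σ t| ≤ e)
    (hφσ' : ∀ t ∈ Icc (0 : ℝ) 1, |deriv φ t - deriv σ t| ≤ C₁ * e) :
    (Summable fun k => ‖coordCoeff σ (fun t => trigSeries c (φ t) * U t) k‖) ∧ ∀ K : ℝ, 0 < K →
      coeffTail (coordCoeff σ (fun t => trigSeries c (φ t) * U t)) K ≤ C₀ * invSqSum * K ^ (-p + 2)
        + K ^ (-(1 / 4) : ℝ) *
          ((derivBound C₀ * C + B + derivBound C₀ * C + derivBound C₀ * C₁) * e / m * invSqrtConst) := by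
  set A := derivBound C₀ with hA
  have hA0 : 0 ≤ A := derivBound_nonneg hC₀
  set d : ℤ → ℂ := fun k => 2 * Real.pi * Complex.I * k * c k with hd
  have hcs := hc.summable_norm hC₀ hp
  have hG := hc.hasDerivAt_trigSeries hC₀ hp
  have hGA := hc.norm_deriv_le hC₀ hp
  have hGL := hc.norm_deriv_sub_le hC₀ hp
  have hGc : Continuous (trigSeries c) := continuous_trigSeries hcs
  have hdc : Continuous (trigSeries d) := by
    refine (LipschitzWith.of_dist_le_mul (K := ⟨A, hA0⟩) fun s t => ?_).continuous
    rw [dist_eq_norm, Real.dist_eq]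
    exact hGL s t
  have hUc : Continuous U := continuous_iff_continuousAt.2 fun t => (hU t).continuousAt
  have hcomp : ∀ {τ : ℝ → ℝ}, IsUnitCoordinate τ → ∀ t,
      HasDerivAt (fun t => trigSeries c (τ t)) (trigSeries d (τ t) * ((deriv τ t : ℝ) : ℂ)) t := by
    intro τ hτ t
    have := (hG (τ t)).scomp t (hτ.differentiable t).hasDerivAt
    rw [Complex.real_smul, mul_comm] at this
    exact this
  -- Subtracting the same series read in `σ` isolates the part with power decay; what is left
  -- vanishes at both endpoints and is small in `C¹`.
  set R : ℝ → ℂ := fun t => trigSeries c (φ t) * U t - trigSeries c (σ t) with hR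
  set R' : ℝ → ℂ := fun t => trigSeries d (φ t) * ((deriv φ t : ℝ) : ℂ) * U t + trigSeries c (φ t) * U' t
    - trigSeries d (σ t) * ((deriv σ t : ℝ) : ℂ) with hR'
  have hRd : ∀ t, HasDerivAt R (R' t) t := fun t => ((hcomp hφ t).mul (hU t)).sub (hcomp hσ t)
  have hofr : ∀ {τ : ℝ → ℝ}, IsUnitCoordinate τ → Continuous fun t => ((deriv τ t : ℝ) : ℂ) :=
    fun hτ => Complex.continuous_ofReal.comp hτ.continuous_deriv
  have hR'c : Continuous R' :=
    ((((hdc.comp hφ.continuous).mul (hofr hφ)).mul hUc).add ((hGc.comp hφ.continuous).mul hU')).sub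
      ((hdc.comp hσ.continuous).mul (hofr hσ))
  have hRper : R 0 = R 1 := by
    simp only [hR, hU0, hU1, hφ.map_zero, hφ.map_one, hσ.map_zero, hσ.map_one, mul_one, sub_self]
  set Q := A * C + B + A * C + A * C₁ with hQ
  have hQ0 : 0 ≤ Q := by positivity
  have hRbound : ∀ t ∈ Icc (0 : ℝ) 1, ‖R' t‖ ≤ Q * e := by
    intro t ht
    have hdp := (hφ.deriv_pos t ht).le
    -- Each summand has one factor that is `O(e)`: `U - 1`, `U'` (weighted by the series), the
    -- difference of the `d`-series at `φ` and `σ`, or `φ' - σ'`.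
    have e1 : R' t = trigSeries d (φ t) * ((deriv φ t : ℝ) : ℂ) * (U t - 1) + trigSeries c (φ t) * U' t
        + (trigSeries d (φ t) - trigSeries d (σ t)) * ((deriv φ t : ℝ) : ℂ)
        + trigSeries d (σ t) * ((deriv φ t - deriv σ t : ℝ) : ℂ) := by
      simp only [hR']; push_cast; ring
    have n1 : ‖((deriv φ t : ℝ) : ℂ)‖ ≤ C := by
      rw [Complex.norm_real, Real.norm_eq_abs, abs_of_nonneg hdp]; exact hφC t ht
    have n2 : ‖((deriv φ t - deriv σ t : ℝ) : ℂ)‖ ≤ C₁ * e := by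
      rw [Complex.norm_real, Real.norm_eq_abs]; exact hφσ' t ht
    have n3 : ‖trigSeries d (φ t) - trigSeries d (σ t)‖ ≤ A * e :=
      (hGL _ _).trans (by gcongr; exact hφσ t ht)
    rw [e1]
    refine (norm_add_le _ _).trans ?_
    refine (add_le_add ((norm_add_le _ _).trans (add_le_add (norm_add_le _ _) le_rfl)) le_rfl).trans ?_
    rw [norm_mul, norm_mul, norm_mul, norm_mul, norm_mul]
    calc _ ≤ A * C * e + B * e + A * e * C + A * (C₁ * e) := by
          have g1 : ‖trigSeries d (φ t)‖ ≤ A := hGA _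
          have g2 : ‖trigSeries d (σ t)‖ ≤ A := hGA _
          refine add_le_add (add_le_add (add_le_add ?_ (hUB t ht)) ?_) ?_
          · gcongr
            exact hUe t ht
          · gcongr
          · gcongr
      _ = Q * e := by rw [hQ]; ring
  have hW : ∀ t ∈ Icc (0 : ℝ) 1, ‖R' t‖ ≤ Q * e / m * deriv σ t := by
    intro t ht
    refine (hRbound t ht).trans ?_
    rw [div_mul_eq_mul_div, le_div_iff₀ hm]
    gcongr
    exact hσm t ht
  obtain ⟨hRs, hRt⟩ := hσ.coeffTail_le_of_hasDerivAt hRd hR'c hRper (by positivity) hW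
  have hRcont : Continuous R := continuous_iff_continuousAt.2 fun t => (hRd t).continuousAt
  have hsplit : coordCoeff σ (fun t => trigSeries c (φ t) * U t) = fun k => c k + coordCoeff σ R k := by
    funext k
    have hadd := hσ.coordCoeff_add (g := fun t => trigSeries c (σ t)) (g' := R)
      (hGc.comp hσ.continuous).continuousOn hRcont.continuousOn k
    rw [hσ.coordCoeff_trigSeries hcs k] at hadd
    rw [← hadd]
    exact coordCoeff_congr (fun t _ => by simp only [hR]; ring) k
  rw [hsplit]
  refine ⟨Summable.of_nonneg_of_le (fun _ => norm_nonneg _) (fun k => norm_add_le _ _) (hcs.add hRs),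
    fun K hK => (coeffTail_add_le hcs hRs K).trans ?_⟩
  exact add_le_add (hc.coeffTail_le hC₀ (by linarith) hK) (hRt K hK)

/-! ### The envelopes -/

/-- The frequencies `|k| < N / 2`. -/
def freqBand (N : ℤ) : Finset ℤ := (Finset.Icc (-N) N).filter fun k => 2 * |k| < N

theorem mem_freqBand {N k : ℤ} : k ∈ freqBand N ↔ 2 * |k| < N := by
  rw [freqBand, Finset.mem_filter, Finset.mem_Icc, and_iff_right_iff_imp]
  intro h
  have := abs_le.1 (show |k| ≤ N by have := abs_nonneg k; omega)
  exact this

theorem cast_abs_lt_iff {N k : ℤ} : (N : ℝ) / 2 ≤ |(k : ℝ)| ↔ k ∉ freqBand N := by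
  rw [mem_freqBand, not_lt, ← Int.cast_abs, div_le_iff₀ two_pos]
  constructor
  · intro h
    have : N ≤ |k| * 2 := by exact_mod_cast h
    linarith
  · intro h
    have : N ≤ |k| * 2 := by linarith
    exact_mod_cast this

theorem norm_trigSeries_sub_sum_le {N : ℤ} (hc : Summable fun k => ‖c k‖) (s : ℝ) :
    ‖trigSeries c s - ∑ k ∈ freqBand N, c k * mode k s‖ ≤ coeffTail c (N / 2) := by
  have h3 : trigSeries c s - ∑ k ∈ freqBand N, c k * mode k s
      = ∑' k, {k : ℤ | (N : ℝ) / 2 ≤ |(k : ℝ)|}.indicator (fun k => c k * mode k s) k := by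
    have h4 : ((freqBand N : Finset ℤ) : Set ℤ)ᶜ = {k : ℤ | (N : ℝ) / 2 ≤ |(k : ℝ)|} := by
      ext k; simp [cast_abs_lt_iff]
    have h5 := (summable_mul_mode hc s).sum_add_tsum_compl (s := freqBand N)
    rw [← tsum_subtype, ← h4, trigSeries, ← h5, add_sub_cancel_left]
  rw [h3]
  refine tsum_of_norm_bounded (hc.indicator {k : ℤ | (N : ℝ) / 2 ≤ |(k : ℝ)|}).hasSum fun k => ?_
  by_cases hk : k ∈ {k : ℤ | (N : ℝ) / 2 ≤ |(k : ℝ)|}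
  · rw [indicator_of_mem hk, indicator_of_mem hk, norm_mul, norm_mode, mul_one]
  · rw [indicator_of_notMem hk, indicator_of_notMem hk, norm_zero]

/-- The demodulated band `2 ∑ ĝ(k + N) exp (2 π i k σ)`, over `|k| < N / 2`. -/
def analyticEnvelope (σ : ℝ → ℝ) (g : ℝ → ℂ) (N : ℤ) (t : ℝ) : ℂ :=
  ∑ k ∈ freqBand N, 2 * coordCoeff σ g (k + N) * mode k (σ t)

/-- The coefficient of `g` at `k + N` is `û(k) / 2` plus half the conjugate of `û(-(k + 2N))` plus
`ĝ₀(k + N)`. For `|k| < N/2` the last two indices have absolute value at least `N/2`, so both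
aliases lie in tails; truncating the series of `u` costs one more tail. -/
theorem IsUnitCoordinate.norm_analyticEnvelope_sub_le (h : IsUnitCoordinate σ) {N : ℤ}
    {g g₀ u : ℝ → ℂ} (hg₀ : ContinuousOn g₀ (Icc 0 1)) (hu : ContinuousOn u (Icc 0 1))
    (hg : ∀ t ∈ Icc (0 : ℝ) 1, g t = g₀ t
      + (1 / 2 * (u t * mode N (σ t)) + 1 / 2 * ((starRingEnd ℂ) (u t) * mode (-N) (σ t))))
    (hg₀s : Summable fun k => ‖coordCoeff σ g₀ k‖) (hus : Summable fun k => ‖coordCoeff σ u k‖) :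
    ∀ t ∈ Icc (0 : ℝ) 1, ‖analyticEnvelope σ g N t - u t‖
      ≤ 2 * coeffTail (coordCoeff σ u) (N / 2) + 2 * coeffTail (coordCoeff σ g₀) (N / 2) := by
  intro t ht
  have hmc : ∀ j, ContinuousOn (fun t => mode j (σ t)) (Icc 0 1) := fun j =>
    ((continuous_mode j).comp h.continuous).continuousOn
  have hcu : ContinuousOn (fun t => (starRingEnd ℂ) (u t)) (Icc 0 1) :=
    Complex.continuous_conj.comp_continuousOn hu
  have hcoef : ∀ k, coordCoeff σ g (k + N) = coordCoeff σ g₀ (k + N)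
      + (1 / 2 * coordCoeff σ u k + 1 / 2 * (starRingEnd ℂ) (coordCoeff σ u (-(k + 2 * N)))) := by
    intro k
    have a1 : ContinuousOn (fun t => 1 / 2 * (u t * mode N (σ t))) (Icc 0 1) :=
      continuousOn_const.mul (hu.mul (hmc N))
    have a2 : ContinuousOn (fun t => 1 / 2 * ((starRingEnd ℂ) (u t) * mode (-N) (σ t))) (Icc 0 1) :=
      continuousOn_const.mul (hcu.mul (hmc (-N)))
    have a12 : ContinuousOn (fun t => 1 / 2 * (u t * mode N (σ t))
      + 1 / 2 * ((starRingEnd ℂ) (u t) * mode (-N) (σ t))) (Icc 0 1) := a1.add a2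
    rw [coordCoeff_congr hg, h.coordCoeff_add hg₀ a12, h.coordCoeff_add a1 a2,
      coordCoeff_const_mul, coordCoeff_const_mul, coordCoeff_mul_mode, coordCoeff_mul_mode,
      coordCoeff_conj, add_sub_cancel_right, show k + N - -N = k + 2 * N by ring]
  have hz : analyticEnvelope σ g N t = (∑ k ∈ freqBand N, coordCoeff σ u k * mode k (σ t))
      + ((∑ k ∈ freqBand N, (starRingEnd ℂ) (coordCoeff σ u (-(k + 2 * N))) * mode k (σ t))
      + 2 * ∑ k ∈ freqBand N, coordCoeff σ g₀ (k + N) * mode k (σ t)) := by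
    rw [analyticEnvelope, Finset.mul_sum, ← Finset.sum_add_distrib, ← Finset.sum_add_distrib]
    refine Finset.sum_congr rfl fun k _ => ?_
    rw [hcoef]; ring
  have hband : ∀ k ∈ freqBand N, 2 * |k| < N := fun k hk => mem_freqBand.1 hk
  have b1 := norm_trigSeries_sub_sum_le (N := N) hus (σ t)
  rw [← h.eq_trigSeries hu hus t ht, norm_sub_rev] at b1
  have b2 : ‖∑ k ∈ freqBand N, (starRingEnd ℂ) (coordCoeff σ u (-(k + 2 * N))) * mode k (σ t)‖
      ≤ coeffTail (coordCoeff σ u) (N / 2) := by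
    refine (norm_sum_le _ _).trans ?_
    simp only [norm_mul, norm_mode, mul_one, RCLike.norm_conj]
    refine sum_norm_le_coeffTail hus (freqBand N) (fun k => -(k + 2 * N)) (fun a _ b _ hab => by
      simpa using hab) fun k hk => ?_
    rw [cast_abs_lt_iff, mem_freqBand, not_lt]
    have := hband k hk
    have h1 := neg_abs_le k
    have h2 := neg_le_abs (-(k + 2 * N))
    have h3 := abs_nonneg k
    omega
  have b3 : ‖∑ k ∈ freqBand N, coordCoeff σ g₀ (k + N) * mode k (σ t)‖
      ≤ coeffTail (coordCoeff σ g₀) (N / 2) := by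
    refine (norm_sum_le _ _).trans ?_
    simp only [norm_mul, norm_mode, mul_one]
    refine sum_norm_le_coeffTail hg₀s (freqBand N) (fun k => k + N) (fun a _ b _ hab => by
      simpa using hab) fun k hk => ?_
    rw [cast_abs_lt_iff, mem_freqBand, not_lt]
    have := hband k hk
    have h1 := neg_abs_le k
    have h2 := le_abs_self (k + N)
    omega
  rw [hz, add_sub_right_comm]
  refine (norm_add_le _ _).trans ?_
  refine (add_le_add b1 (norm_add_le _ _)).trans ?_
  rw [norm_mul, Complex.norm_ofNat]
  linarith

theorem phaseCoeff_intCast (θ f : ℝ → ℝ) (k : ℤ) :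
    phaseCoeff θ f (k : ℝ) = coordCoeff (normalizedPhase θ) (fun t => (f t : ℂ)) k := by
  rw [phaseCoeff, coordCoeff]
  congr 1; funext t
  rw [mode]
  congr 3
  push_cast; ring

theorem coordCoeff_ofReal_neg (f : ℝ → ℝ) (k : ℤ) :
    coordCoeff σ (fun t => (f t : ℂ)) (-k) = (starRingEnd ℂ) (coordCoeff σ (fun t => (f t : ℂ)) k) := by
  have := coordCoeff_conj (σ := σ) (fun t => (f t : ℂ)) (-k)
  simpa using this

theorem cutoffSynthesis_eq {ψ : ℝ → ℝ} {N : ℤ} (hN : 0 < N) (hψ : numPeriods ψ = N) (c : ℤ → ℂ) (t : ℝ) :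
    cutoffSynthesis ψ c t = ∑ k ∈ freqBand N, c k * mode k (normalizedPhase ψ t) := by
  rw [cutoffSynthesis, hψ, Int.floor_intCast, freqBand, Finset.sum_filter]
  refine Finset.sum_congr rfl fun k _ => ?_
  have hNR : (0 : ℝ) < N := by exact_mod_cast hN
  have : (-(1 / 2) < (k : ℝ) / N ∧ (k : ℝ) / N < 1 / 2) ↔ 2 * |k| < N := by
    rw [← abs_lt, abs_div, abs_of_pos hNR, div_lt_iff₀ hNR, ← Int.cast_abs]
    constructor
    · intro h
      have : (2 : ℝ) * (|k| : ℤ) < N := by linarith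
      exact_mod_cast this
    · intro h
      have : (2 : ℝ) * (|k| : ℤ) < N := by exact_mod_cast h
      linarith
  rw [cutoff]
  by_cases hk : 2 * |k| < N
  · rw [if_pos (this.2 hk), if_pos hk, mul_one]
  · rw [if_neg (fun h => hk (this.1 h)), if_neg hk, mul_zero, zero_mul]

theorem sum_freqBand_conj (N : ℤ) (x : ℤ → ℂ) (s : ℝ) :
    ∑ k ∈ freqBand N, (starRingEnd ℂ) (x (-k)) * mode k s
      = (starRingEnd ℂ) (∑ k ∈ freqBand N, x k * mode k s) := by
  rw [map_sum]
  refine Finset.sum_nbij' (fun k => -k) (fun k => -k) ?_ ?_ ?_ ?_ ?_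
  · intro k hk; rw [mem_freqBand] at *; rwa [abs_neg]
  · intro k hk; rw [mem_freqBand] at *; rwa [abs_neg]
  · simp
  · simp
  · intro k _; rw [map_mul, conj_mode, neg_neg]

/-- For real `f` the coefficient at `k - N` is the conjugate of the one at `-k + N`, and the band is
symmetric. So the two synthesized sums are `y + ȳ` and `-i(y - ȳ)`, and the analytic envelope is
`2y`. -/
theorem envelope_eq {ψ : ℝ → ℝ} {N : ℤ} (hN : 0 < N) (hψ : numPeriods ψ = N) (f : ℝ → ℝ) (t : ℝ) :
    envelopeA ψ f t = (analyticEnvelope (normalizedPhase ψ) (fun t => (f t : ℂ)) N t).re ∧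
    envelopeB ψ f t = (analyticEnvelope (normalizedPhase ψ) (fun t => (f t : ℂ)) N t).im := by
  set x : ℤ → ℂ := fun k => coordCoeff (normalizedPhase ψ) (fun t => (f t : ℂ)) (k + N) with hx
  have h1 : ∀ k : ℤ, phaseCoeff ψ f ((k : ℝ) + numPeriods ψ) = x k := by
    intro k
    rw [hψ, ← Int.cast_add, phaseCoeff_intCast]
  have h2 : ∀ k : ℤ, phaseCoeff ψ f ((k : ℝ) - numPeriods ψ) = (starRingEnd ℂ) (x (-k)) := by
    intro k
    rw [hψ, ← Int.cast_sub, phaseCoeff_intCast, hx, ← coordCoeff_ofReal_neg]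
    congr 1; ring
  set y := ∑ k ∈ freqBand N, x k * mode k (normalizedPhase ψ t) with hy
  have hz : analyticEnvelope (normalizedPhase ψ) (fun t => (f t : ℂ)) N t = 2 * y := by
    rw [analyticEnvelope, hy, Finset.mul_sum]
    exact Finset.sum_congr rfl fun k _ => by rw [mul_assoc]
  have hA : cutoffSynthesis ψ (fun k => phaseCoeff ψ f ((k : ℝ) + numPeriods ψ)
      + phaseCoeff ψ f ((k : ℝ) - numPeriods ψ)) t = y + (starRingEnd ℂ) y := by
    rw [cutoffSynthesis_eq hN hψ, hy, ← sum_freqBand_conj, ← Finset.sum_add_distrib]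
    exact Finset.sum_congr rfl fun k _ => by rw [h1, h2]; ring
  have hB : cutoffSynthesis ψ (fun k => -Complex.I * (phaseCoeff ψ f ((k : ℝ) + numPeriods ψ)
      - phaseCoeff ψ f ((k : ℝ) - numPeriods ψ))) t = -Complex.I * (y - (starRingEnd ℂ) y) := by
    rw [cutoffSynthesis_eq hN hψ, hy, ← sum_freqBand_conj, ← Finset.sum_sub_distrib, Finset.mul_sum]
    exact Finset.sum_congr rfl fun k _ => by rw [h1, h2]; ring
  rw [envelopeA, envelopeB, hA, hB, hz]
  constructor
  · simp; ring
  · simp; ring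

/-! ### Coefficients in the time coordinate -/

theorem isUnitCoordinate_id : IsUnitCoordinate (fun t => t) where
  differentiable := differentiable_id
  continuous_deriv := by simpa using continuous_const
  deriv_pos := by simp
  map_zero := rfl
  map_one := rfl

theorem timeCoeff_eq_coordCoeff (g : ℝ → ℝ) (k : ℤ) :
    timeCoeff g k = coordCoeff (fun t => t) (fun t => (g t : ℂ)) k := by
  simp [timeCoeff, coordCoeff]

theorem timeCoeff_neg (g : ℝ → ℝ) (k : ℤ) : timeCoeff g (-k) = (starRingEnd ℂ) (timeCoeff g k) := by
  rw [timeCoeff_eq_coordCoeff, timeCoeff_eq_coordCoeff, coordCoeff_ofReal_neg]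

theorem timeCoeff_add {g h : ℝ → ℝ} (hg : ContinuousOn g (Icc 0 1)) (hh : ContinuousOn h (Icc 0 1))
    (k : ℤ) : timeCoeff (fun t => g t + h t) k = timeCoeff g k + timeCoeff h k := by
  simp only [timeCoeff_eq_coordCoeff, Complex.ofReal_add]
  exact isUnitCoordinate_id.coordCoeff_add (Complex.continuous_ofReal.comp_continuousOn hg)
    (Complex.continuous_ofReal.comp_continuousOn hh) k

theorem timeCoeff_congr {g h : ℝ → ℝ} (H : ∀ t ∈ Icc (0 : ℝ) 1, g t = h t) (k : ℤ) :
    timeCoeff g k = timeCoeff h k :=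
  intervalIntegral_congr_Icc fun t ht => by rw [H t ht]

/-- The trigonometric polynomial with coefficients `c k`, `|k| ≤ M`. -/
def trigPoly (M : ℕ) (c : ℤ → ℂ) (t : ℝ) : ℂ := ∑ k ∈ Finset.Icc (-(M : ℤ)) (M : ℤ), c k * mode k t

/-- The `ℓ¹` norm of the coefficients `c k`, `|k| ≤ M`. -/
def polyNorm (M : ℕ) (c : ℤ → ℂ) : ℝ := ∑ k ∈ Finset.Icc (-(M : ℤ)) (M : ℤ), ‖c k‖

variable {M : ℕ}

theorem polyNorm_nonneg (M : ℕ) (c : ℤ → ℂ) : 0 ≤ polyNorm M c := Finset.sum_nonneg fun _ _ => norm_nonneg _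

theorem continuous_trigPoly (M : ℕ) (c : ℤ → ℂ) : Continuous (trigPoly M c) :=
  continuous_finsetSum _ fun k _ => continuous_const.mul (continuous_mode k)

theorem norm_trigPoly_le (M : ℕ) (c : ℤ → ℂ) (t : ℝ) : ‖trigPoly M c t‖ ≤ polyNorm M c := by
  refine (norm_sum_le _ _).trans_eq ?_
  simp [norm_mode, polyNorm]

theorem mem_trigSpace_iff {g : ℝ → ℂ} : g ∈ trigSpace M ↔ ∃ c : ℤ → ℂ, ∀ t, g t = trigPoly M c t := by
  rw [trigSpace, ← Finset.coe_Icc, Submodule.mem_span_image_finset_iff_exists_fun']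
  refine exists_congr fun c => ?_
  rw [eq_comm, funext_iff]
  simp [trigPoly]

theorem trigPoly_add (c d : ℤ → ℂ) (t : ℝ) :
    trigPoly M (fun k => c k + d k) t = trigPoly M c t + trigPoly M d t := by
  simp only [trigPoly, add_mul, Finset.sum_add_distrib]

theorem timeCoeff_of_eq_trigPoly {g : ℝ → ℝ} (hg : ∀ t ∈ Icc (0 : ℝ) 1, (g t : ℂ) = trigPoly M c t)
    (k : ℤ) : timeCoeff g k = if k ∈ Finset.Icc (-(M : ℤ)) (M : ℤ) then c k else 0 := by
  set d : ℤ → ℂ := fun k => if k ∈ Finset.Icc (-(M : ℤ)) (M : ℤ) then c k else 0 with hd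
  have hsum : Summable fun k => ‖d k‖ :=
    summable_of_ne_finset_zero (s := Finset.Icc (-(M : ℤ)) (M : ℤ)) fun k hk => by
      simp only [hd, if_neg hk, norm_zero]
  rw [timeCoeff_eq_coordCoeff]
  refine (coordCoeff_congr (fun t ht => ?_) k).trans (isUnitCoordinate_id.coordCoeff_trigSeries hsum k)
  rw [hg t ht, trigPoly, trigSeries, tsum_eq_sum (s := Finset.Icc (-(M : ℤ)) (M : ℤ)) fun k hk => by
    simp only [hd, if_neg hk, zero_mul]]
  exact Finset.sum_congr rfl fun k hk => by simp only [hd, if_pos hk]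

theorem fourierL1_of_eq_trigPoly {g : ℝ → ℝ} (hg : ∀ t ∈ Icc (0 : ℝ) 1, (g t : ℂ) = trigPoly M c t) :
    fourierL1 g = ENNReal.ofReal (polyNorm M c) := by
  rw [fourierL1, tsum_eq_sum (s := Finset.Icc (-(M : ℤ)) (M : ℤ)) fun k hk => by
    rw [timeCoeff_of_eq_trigPoly hg, if_neg hk, enorm_zero], polyNorm,
    ENNReal.ofReal_sum_of_nonneg fun _ _ => norm_nonneg _]
  refine Finset.sum_congr rfl fun k hk => ?_
  rw [timeCoeff_of_eq_trigPoly hg, if_pos hk, ofReal_norm]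

/-- Conjugate symmetry of the coefficients makes the sum real, so the real part in `trigProj`
discards nothing. -/
theorem ofReal_trigProj (M : ℕ) (g : ℝ → ℝ) (t : ℝ) :
    (trigProj M g t : ℂ) = trigPoly M (timeCoeff g) t := by
  rw [trigProj]
  refine Complex.conj_eq_iff_re.1 ?_
  rw [map_sum]
  refine Finset.sum_nbij' (fun k => -k) (fun k => -k) ?_ ?_ ?_ ?_ ?_
  · intro k hk; rw [Finset.mem_Icc] at *; omega
  · intro k hk; rw [Finset.mem_Icc] at *; omega
  · simp
  · simp
  · intro k _; rw [map_mul, conj_mode, timeCoeff_neg]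

theorem trigProj_add_of_eq_trigPoly {g h : ℝ → ℝ} (hg : ∀ t, (g t : ℂ) = trigPoly M c t)
    (hh : ContinuousOn h (Icc 0 1)) (t : ℝ) :
    trigProj M (fun t => g t + h t) t = g t + trigProj M h t := by
  have hgc : Continuous g := by
    have : g = fun t => (trigPoly M c t).re := by funext t; rw [← hg t, Complex.ofReal_re]
    rw [this]
    exact Complex.continuous_re.comp (continuous_trigPoly M c)
  apply Complex.ofReal_injective
  rw [Complex.ofReal_add, ofReal_trigProj, ofReal_trigProj, hg t, ← trigPoly_add]
  refine Finset.sum_congr rfl fun k hk => ?_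
  rw [timeCoeff_add hgc.continuousOn hh, timeCoeff_of_eq_trigPoly fun t _ => hg t, if_pos hk]

theorem trigProj_congr {g h : ℝ → ℝ} (H : ∀ t ∈ Icc (0 : ℝ) 1, g t = h t) (t : ℝ) :
    trigProj M g t = trigProj M h t := by
  simp only [trigProj, timeCoeff_congr H]

/-! ### The derivative of the argument -/

/-- After scaling by `x`, the argument is `Im log (1 + w)` with `‖w‖ ≤ δ / m ≤ 1/2`, where `‖log (1
+ w)‖ ≤ (3/2) ‖w‖`. -/
theorem abs_arg_le_of_norm_sub_le {v : ℂ} {x m δ : ℝ} (hm : 0 < m) (hx : m ≤ x) (hδ : δ ≤ m / 2)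
    (hv : ‖v - x‖ ≤ δ) : |v.arg| ≤ 3 / 2 * (δ / m) := by
  have hx0 : 0 < x := hm.trans_le hx
  have hδ0 : 0 ≤ δ := (norm_nonneg _).trans hv
  set w : ℂ := (v - x) / x with hw
  have hxc : (x : ℂ) ≠ 0 := by exact_mod_cast hx0.ne'
  have hvw : v = x * (1 + w) := by rw [hw]; field_simp; ring
  have hwn : ‖w‖ ≤ δ / m := by
    rw [hw, norm_div, Complex.norm_real, Real.norm_eq_abs, abs_of_pos hx0]
    gcongr
  have hδm : δ / m ≤ 1 / 2 := by rw [div_le_iff₀ hm]; linarith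
  rw [hvw, Complex.arg_real_mul _ hx0, ← Complex.log_im]
  calc |(Complex.log (1 + w)).im| ≤ ‖Complex.log (1 + w)‖ := Complex.abs_im_le_norm _
    _ ≤ 3 / 2 * ‖w‖ := Complex.norm_log_one_add_half_le_self (hwn.trans hδm)
    _ ≤ _ := by gcongr

theorem arctanRate_re_im {z z' : ℝ → ℂ} (hz : ∀ t, HasDerivAt z (z' t) t) (t : ℝ) :
    arctanRate (fun t => (z t).re) (fun t => (z t).im) t = (z' t / z t).im := by
  have h1 : deriv (fun t => (z t).re) t = (z' t).re :=
    (Complex.reCLM.hasFDerivAt.comp_hasDerivAt t (hz t)).deriv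
  have h2 : deriv (fun t => (z t).im) t = (z' t).im :=
    (Complex.imCLM.hasFDerivAt.comp_hasDerivAt t (hz t)).deriv
  rw [arctanRate, h1, h2, Complex.div_im, Complex.normSq_apply]
  ring

/-- If `z` is close to `x exp (i ω)` with `x ≥ m > 0`, then the Fourier coefficients of
`(arg z)' - ω'` are small. -/
theorem norm_timeCoeff_arctanRate_sub_le {z z' : ℝ → ℂ} {ω ω' x : ℝ → ℝ} {m δ : ℝ}
    (hz : ∀ t, HasDerivAt z (z' t) t) (hz' : Continuous z') (hω : ∀ t, HasDerivAt ω (ω' t) t)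
    (hω' : Continuous ω') (hm : 0 < m) (hx : ∀ t ∈ Icc (0 : ℝ) 1, m ≤ x t) (hδ : δ ≤ m / 2)
    (hzx : ∀ t ∈ Icc (0 : ℝ) 1, ‖z t - x t * Complex.exp (ω t * Complex.I)‖ ≤ δ)
    (hz01 : z 0 = z 1)
    (hω01 : Complex.exp (ω 0 * Complex.I) = Complex.exp (ω 1 * Complex.I)) :
    ContinuousOn (fun t => arctanRate (fun t => (z t).re) (fun t => (z t).im) t - ω' t) (Icc 0 1) ∧
    ∀ k, ‖timeCoeff (fun t => arctanRate (fun t => (z t).re) (fun t => (z t).im) t - ω' t) k‖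
      ≤ 2 * Real.pi * |(k : ℝ)| * (3 / 2 * (δ / m)) := by
  -- Removing the expected rotation puts `v` in the right half-plane, where the principal argument
  -- is smooth. Its derivative is exactly `(arg z)' - ω'`.
  set v : ℝ → ℂ := fun t => z t * Complex.exp (-(ω t * Complex.I)) with hv
  have hexp : ∀ t, HasDerivAt (fun t => Complex.exp (-((ω t : ℂ) * Complex.I)))
      (Complex.exp (-(ω t * Complex.I)) * -(ω' t * Complex.I)) t := fun t =>
    (((hω t).ofReal_comp.mul_const Complex.I).neg).cexp
  have hvd : ∀ t, HasDerivAt v (z' t * Complex.exp (-(ω t * Complex.I))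
      + z t * (Complex.exp (-(ω t * Complex.I)) * -(ω' t * Complex.I))) t := fun t =>
    (hz t).mul (hexp t)
  have hvx : ∀ t ∈ Icc (0 : ℝ) 1, ‖v t - x t‖ ≤ δ := by
    intro t ht
    have h1 : v t - x t = (z t - x t * Complex.exp (ω t * Complex.I))
        * Complex.exp (-(ω t * Complex.I)) := by
      rw [sub_mul, mul_assoc, ← Complex.exp_add]; simp [hv]
    have h2 : ‖Complex.exp (-((ω t : ℂ) * Complex.I))‖ = 1 := by
      rw [← neg_mul, ← Complex.ofReal_neg, Complex.norm_exp_ofReal_mul_I]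
    rw [h1, norm_mul, h2, mul_one]
    exact hzx t ht
  have hre : ∀ t ∈ Icc (0 : ℝ) 1, 0 < (v t).re := by
    intro t ht
    have h1 := (Complex.abs_re_le_norm (v t - x t)).trans (hvx t ht)
    rw [Complex.sub_re, Complex.ofReal_re] at h1
    have := hx t ht
    have := (abs_le.1 h1).1
    linarith
  have hslit : ∀ t ∈ Icc (0 : ℝ) 1, v t ∈ Complex.slitPlane := fun t ht => Or.inl (hre t ht)
  have hz0 : ∀ t ∈ Icc (0 : ℝ) 1, z t ≠ 0 := by
    intro t ht h0
    have := hre t ht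
    simp [hv, h0] at this
  set ρ : ℝ → ℝ := fun t => arctanRate (fun t => (z t).re) (fun t => (z t).im) t - ω' t with hρ
  have hzc : Continuous z := continuous_iff_continuousAt.2 fun t => (hz t).continuousAt
  have hρc : ContinuousOn ρ (Icc 0 1) := by
    simp only [hρ, arctanRate_re_im hz]
    exact (Complex.continuous_im.comp_continuousOn (hz'.continuousOn.div hzc.continuousOn hz0)).sub
      hω'.continuousOn
  set r : ℝ → ℝ := fun t => (v t).arg with hr
  have hrd : ∀ t ∈ Icc (0 : ℝ) 1, HasDerivAt r (ρ t) t := by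
    intro t ht
    have h1 := Complex.imCLM.hasFDerivAt.comp_hasDerivAt t ((hvd t).clog_real (hslit t ht))
    have h2 : r = Complex.imCLM ∘ fun t => Complex.log (v t) := by
      funext t; simp [hr, Complex.log_im]
    rw [h2]
    refine h1.congr_deriv ?_
    have h3 := hz0 t ht
    have h4 := Complex.exp_ne_zero (-(ω t * Complex.I))
    have h5 : (z' t * Complex.exp (-(ω t * Complex.I))
      + z t * (Complex.exp (-(ω t * Complex.I)) * -(ω' t * Complex.I))) / v t
        = z' t / z t - ω' t * Complex.I := by
      rw [hv]; field_simp; ring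
    rw [h5, hρ]
    simp only [arctanRate_re_im hz]
    simp
  have hv01 : v 0 = v 1 := by
    simp only [hv, Complex.exp_neg, hz01, hω01]
  have hr01 : r 0 = r 1 := by simp only [hr, hv01]
  have hrb : ∀ t ∈ Icc (0 : ℝ) 1, |r t| ≤ 3 / 2 * (δ / m) := fun t ht =>
    abs_arg_le_of_norm_sub_le hm (hx t ht) hδ (hvx t ht)
  refine ⟨hρc, fun k => ?_⟩
  have h01 : uIcc (0 : ℝ) 1 = Icc 0 1 := uIcc_of_le zero_le_one
  -- The derivative is moved onto the mode, so only the sup bound on `r` enters and no estimate of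
  -- `z'` is needed.
  have hparts := intervalIntegral.integral_mul_deriv_eq_deriv_mul (a := 0) (b := 1)
    (u := fun t => (r t : ℂ)) (u' := fun t => (ρ t : ℂ)) (v := mode (-k))
    (v' := fun t => 2 * Real.pi * Complex.I * ((-k : ℤ) : ℂ) * mode (-k) t)
    (fun t ht => (hrd t (by rwa [h01] at ht)).ofReal_comp) (fun t _ => hasDerivAt_mode (-k) t)
    (intervalIntegrable_of_continuousOn_unit (Complex.continuous_ofReal.comp_continuousOn hρc))
    ((continuous_const.mul (continuous_mode _)).intervalIntegrable _ _)
  rw [mode_zero_right, mode_one_right, hr01, sub_self, zero_sub] at hparts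
  rw [timeCoeff, ← norm_neg, ← hparts]
  refine (intervalIntegral.norm_integral_le_of_norm_le_const (C := 2 * Real.pi * |(k : ℝ)| *
    (3 / 2 * (δ / m))) fun t ht => ?_).trans_eq (by simp)
  rw [uIoc_of_le zero_le_one] at ht
  rw [norm_mul, norm_mul, norm_mode, mul_one, norm_two_pi_I_mul, Complex.norm_real, Real.norm_eq_abs,
    Int.cast_neg, abs_neg, mul_comm]
  gcongr
  exact hrb t (Ioc_subset_Icc_self ht)

theorem IsUnitCoordinate.exists_hasDerivAt_analyticEnvelope (h : IsUnitCoordinate σ) (g : ℝ → ℂ) (N : ℤ) :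
    ∃ z' : ℝ → ℂ, Continuous z' ∧ ∀ t, HasDerivAt (analyticEnvelope σ g N) (z' t) t := by
  refine ⟨fun t => ∑ k ∈ freqBand N, 2 * coordCoeff σ g (k + N)
    * (((deriv σ t : ℝ) : ℂ) * (2 * Real.pi * Complex.I * k * mode k (σ t))), ?_, fun t => ?_⟩
  · exact continuous_finsetSum _ fun k _ => continuous_const.mul
      ((Complex.continuous_ofReal.comp h.continuous_deriv).mul
        (continuous_const.mul ((continuous_mode k).comp h.continuous)))
  · refine HasDerivAt.fun_sum fun k _ => HasDerivAt.const_mul _ ?_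
    have := (hasDerivAt_mode k (σ t)).scomp t (h.differentiable t).hasDerivAt
    rw [Complex.real_smul] at this
    exact this

theorem IsUnitCoordinate.analyticEnvelope_zero_eq_one (h : IsUnitCoordinate σ) (g : ℝ → ℂ) (N : ℤ) :
    analyticEnvelope σ g N 0 = analyticEnvelope σ g N 1 := by
  simp only [analyticEnvelope, h.map_zero, h.map_one, mode_zero_right, mode_one_right]

/-! ### Phases and their normalizations -/

variable {θ ψ : ℝ → ℝ}

theorem HasFrequencyIn.continuous_deriv (h : HasFrequencyIn M θ) : Continuous (deriv θ) := by
  obtain ⟨c, hc⟩ := mem_trigSpace_iff.1 h.2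
  have : deriv θ = fun t => (trigPoly M c t).re := by
    funext t; rw [← hc t, Complex.ofReal_re]
  rw [this]
  exact Complex.continuous_re.comp (continuous_trigPoly M c)

theorem sub_eq_numPeriods (θ : ℝ → ℝ) : θ 1 - θ 0 = 2 * Real.pi * numPeriods θ := by
  rw [numPeriods]; field_simp

theorem deriv_normalizedPhase (θ : ℝ → ℝ) (t : ℝ) :
    deriv (normalizedPhase θ) t = deriv θ t / (θ 1 - θ 0) := by
  have : normalizedPhase θ = fun t => (θ t - θ 0) / (θ 1 - θ 0) := rfl
  rw [this, deriv_div_const, deriv_sub_const]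

theorem HasFrequencyIn.isUnitCoordinate (h : HasFrequencyIn M θ) (hN : 0 < numPeriods θ)
    (hpos : ∀ t ∈ Icc (0 : ℝ) 1, 0 < deriv θ t) : IsUnitCoordinate (normalizedPhase θ) := by
  have h0 : 0 < θ 1 - θ 0 := by rw [sub_eq_numPeriods]; positivity
  exact {
    differentiable := (h.1.sub_const _).div_const _
    continuous_deriv := by
      rw [funext (deriv_normalizedPhase θ)]
      exact h.continuous_deriv.div_const _
    deriv_pos := fun t ht => by rw [deriv_normalizedPhase]; exact div_pos (hpos t ht) h0
    map_zero := by simp [normalizedPhase]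
    map_one := div_self h0.ne' }

theorem mul_normalizedPhase (hN : numPeriods θ ≠ 0) (t : ℝ) :
    2 * Real.pi * numPeriods θ * normalizedPhase θ t = θ t - θ 0 := by
  have : θ 1 - θ 0 ≠ 0 := by rw [sub_eq_numPeriods]; positivity
  rw [normalizedPhase, ← sub_eq_numPeriods]; field_simp

theorem mul_deriv_normalizedPhase (hN : numPeriods θ ≠ 0) (t : ℝ) :
    2 * Real.pi * numPeriods θ * deriv (normalizedPhase θ) t = deriv θ t := by
  have : θ 1 - θ 0 ≠ 0 := by rw [sub_eq_numPeriods]; positivity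
  rw [deriv_normalizedPhase, ← sub_eq_numPeriods]; field_simp

/-- The deviation `(θ - θ(0)) - (ψ - ψ(0))` of two phases. -/
def phaseDeviation (θ ψ : ℝ → ℝ) (t : ℝ) : ℝ := (θ t - θ 0) - (ψ t - ψ 0)

theorem hasDerivAt_phaseDeviation (hθ : Differentiable ℝ θ) (hψ : Differentiable ℝ ψ) (t : ℝ) :
    HasDerivAt (phaseDeviation θ ψ) (deriv θ t - deriv ψ t) t :=
  ((hθ t).hasDerivAt.sub_const _).sub ((hψ t).hasDerivAt.sub_const _)

theorem abs_phaseDeviation_le (hθ : Differentiable ℝ θ) (hψ : Differentiable ℝ ψ) {e : ℝ}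
    (he : ∀ t, |deriv θ t - deriv ψ t| ≤ e) {t : ℝ} (ht : t ∈ Icc (0 : ℝ) 1) :
    |phaseDeviation θ ψ t| ≤ e := by
  have h1 := Convex.norm_image_sub_le_of_norm_hasDerivWithin_le (f := phaseDeviation θ ψ) (s := univ)
    (C := e) (x := 0) (y := t) (fun x _ => (hasDerivAt_phaseDeviation hθ hψ x).hasDerivWithinAt)
    (fun x _ => he x) convex_univ trivial trivial
  have h2 : phaseDeviation θ ψ 0 = 0 := by simp [phaseDeviation]
  rw [h2, sub_zero, sub_zero, Real.norm_eq_abs, Real.norm_eq_abs, abs_of_nonneg ht.1] at h1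
  have he0 : 0 ≤ e := (abs_nonneg _).trans (he 0)
  exact h1.trans (mul_le_of_le_one_right he0 ht.2)

/-- Clearing denominators gives `2πN (θ̄ - ψ̄) = D - D(1) θ̄`, where `N = L_ψ` and `D` is the phase
deviation. The right side is at most `2e`, and `2πN ≥ 2`. -/
theorem abs_normalizedPhase_sub_le (hθ : HasFrequencyIn M θ) (hψ : HasFrequencyIn M ψ)
    (hθ' : IsUnitCoordinate (normalizedPhase θ)) (hL : 0 < numPeriods θ) (hN : 1 ≤ numPeriods ψ) {e : ℝ}
    (he : ∀ t, |deriv θ t - deriv ψ t| ≤ e) {t : ℝ} (ht : t ∈ Icc (0 : ℝ) 1) :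
    |normalizedPhase θ t - normalizedPhase ψ t| ≤ e := by
  have e0 := mul_normalizedPhase hL.ne' t
  have e1 := mul_normalizedPhase (θ := ψ) (by linarith) t
  have e2 := sub_eq_numPeriods θ
  have e3 := sub_eq_numPeriods ψ
  have d0 := abs_le.1 (abs_phaseDeviation_le hθ.1 hψ.1 he ht)
  have d1 := abs_le.1 (abs_phaseDeviation_le hθ.1 hψ.1 he (t := 1) (right_mem_Icc.2 zero_le_one))
  have hφ := hθ'.mapsTo ht
  have he0 : 0 ≤ e := (abs_nonneg _).trans (he 0)
  have hpi := Real.pi_gt_three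
  have key : 2 * Real.pi * numPeriods ψ * (normalizedPhase θ t - normalizedPhase ψ t)
      = phaseDeviation θ ψ t - phaseDeviation θ ψ 1 * normalizedPhase θ t := by
    simp only [phaseDeviation]
    linear_combination e0 - e1 - normalizedPhase θ t * (e3 - e2)
  have hb : |phaseDeviation θ ψ t - phaseDeviation θ ψ 1 * normalizedPhase θ t| ≤ e + e * 1 := by
    refine (abs_sub _ _).trans (add_le_add (abs_le.2 d0) ?_)
    rw [abs_mul, abs_of_nonneg hφ.1]
    exact mul_le_mul (abs_le.2 d1) hφ.2 hφ.1 he0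
  rw [← key, abs_mul, abs_of_pos (by positivity)] at hb
  have h2 : 2 ≤ 2 * Real.pi * numPeriods ψ := by nlinarith
  have := mul_le_mul_of_nonneg_right h2 (abs_nonneg (normalizedPhase θ t - normalizedPhase ψ t))
  linarith

/-- The derivative of the preceding identity. The division by `L_ψ` is kept because it later yields
a lower bound on `ψ̄'` for large `L`. -/
theorem abs_deriv_normalizedPhase_sub_le (hθ : HasFrequencyIn M θ) (hψ : HasFrequencyIn M ψ)
    (hL : 0 < numPeriods θ) (hN : 1 ≤ numPeriods ψ) {e C : ℝ}
    (he : ∀ t, |deriv θ t - deriv ψ t| ≤ e) {t : ℝ} (hC : |deriv (normalizedPhase θ) t| ≤ C) :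
    |deriv (normalizedPhase θ) t - deriv (normalizedPhase ψ) t| ≤ (1 + C) * e / numPeriods ψ := by
  have e0 := mul_deriv_normalizedPhase hL.ne' t
  have e1 := mul_deriv_normalizedPhase (θ := ψ) (by linarith) t
  have e2 := sub_eq_numPeriods θ
  have e3 := sub_eq_numPeriods ψ
  have d1 := abs_phaseDeviation_le hθ.1 hψ.1 he (t := 1) (right_mem_Icc.2 zero_le_one)
  have he0 : 0 ≤ e := (abs_nonneg _).trans (he 0)
  have hpi := Real.pi_gt_three
  have key : 2 * Real.pi * numPeriods ψ * (deriv (normalizedPhase θ) t - deriv (normalizedPhase ψ) t)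
      = (deriv θ t - deriv ψ t) - phaseDeviation θ ψ 1 * deriv (normalizedPhase θ) t := by
    simp only [phaseDeviation]
    linear_combination e0 - e1 - deriv (normalizedPhase θ) t * (e3 - e2)
  have hb : |(deriv θ t - deriv ψ t) - phaseDeviation θ ψ 1 * deriv (normalizedPhase θ) t|
      ≤ e + e * C := by
    refine (abs_sub _ _).trans (add_le_add (he t) ?_)
    rw [abs_mul]
    exact mul_le_mul d1 hC (abs_nonneg _) he0
  rw [← key, abs_mul, abs_of_pos (by positivity)] at hb
  rw [le_div_iff₀ (by linarith)]
  have h2 : numPeriods ψ ≤ 2 * Real.pi * numPeriods ψ := by nlinarith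
  have := mul_le_mul_of_nonneg_right h2
    (abs_nonneg (deriv (normalizedPhase θ) t - deriv (normalizedPhase ψ) t))
  linarith

/-! ### One step of the iteration -/

/-- The Lipschitz constant in the envelope estimate. -/
def envelopeLip (C₀ B C c₀ : ℝ) : ℝ :=
  (derivBound C₀ * C + B + derivBound C₀ * C + derivBound C₀ * (1 + C)) / (c₀ / 2) * invSqrtConst

/-- The bound for the distance between the computed and the exact envelope. -/
def envelopeError (C₀ B C c₀ p L e : ℝ) : ℝ :=
  4 * (C₀ * invSqSum * (L / 4) ^ (-p + 2) + (L / 4) ^ (-(1 / 4) : ℝ) * (envelopeLip C₀ B C c₀ * e))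

theorem envelopeLip_nonneg {C₀ B C c₀ : ℝ} (hC₀ : 0 ≤ C₀) (hB : 0 ≤ B) (hC : 0 ≤ C) (hc₀ : 0 < c₀) :
    0 ≤ envelopeLip C₀ B C c₀ := by
  have := derivBound_nonneg hC₀
  have := invSqrtConst_nonneg
  unfold envelopeLip; positivity

theorem trigSeries_const_mul (a : ℂ) (c : ℤ → ℂ) (s : ℝ) :
    trigSeries (fun k => a * c k) s = a * trigSeries c s := by
  simp only [trigSeries, mul_assoc, tsum_mul_left]

theorem norm_timeCoeff_arctanRate_envelope_le {C₀ p m B C c₀ e : ℝ} {f₁ f₀ : ℝ → ℝ} {L : ℕ} {N : ℤ}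
    (hC₀ : 0 ≤ C₀) (hp : 4 ≤ p) (hf₁ : ContinuousOn f₁ (Icc 0 1)) (hf₀ : ContinuousOn f₀ (Icc 0 1))
    (hm : 0 < m) (hfm : ∀ t ∈ Icc (0 : ℝ) 1, m ≤ f₁ t) (hfB : ∀ t ∈ Icc (0 : ℝ) 1, |f₁ t| ≤ B)
    (hθ : HasFrequencyIn M θ) (hφ : IsUnitCoordinate (normalizedPhase θ)) (hL : numPeriods θ = L)
    (hL1 : 0 < L) (hc₀ : 0 < c₀) (hφc : ∀ t ∈ Icc (0 : ℝ) 1, c₀ ≤ deriv (normalizedPhase θ) t)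
    (hφC : ∀ t ∈ Icc (0 : ℝ) 1, deriv (normalizedPhase θ) t ≤ C)
    (hd₀ : HasPowerDecay (coordCoeff (normalizedPhase θ) fun t => (f₀ t : ℂ)) C₀ p)
    (hd₁ : HasPowerDecay (coordCoeff (normalizedPhase θ) fun t => (f₁ t : ℂ)) C₀ p)
    (hψ : HasFrequencyIn M ψ) (hN : numPeriods ψ = N) (hN1 : 1 ≤ N) (hNL : (L : ℝ) / 2 ≤ N)
    (hψpos : ∀ t ∈ Icc (0 : ℝ) 1, 0 < deriv ψ t) (he : ∀ t, |deriv θ t - deriv ψ t| ≤ e)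
    (hsmall : (1 + C) * e / N ≤ c₀ / 2) (herr : envelopeError C₀ B C c₀ p L e ≤ m / 2) :
    let ρ : ℝ → ℝ := fun t =>
      arctanRate (envelopeA ψ fun s => f₀ s + f₁ s * Real.cos (θ s))
        (envelopeB ψ fun s => f₀ s + f₁ s * Real.cos (θ s)) t - (deriv θ t - deriv ψ t)
    ContinuousOn ρ (Icc 0 1) ∧ ∀ k, ‖timeCoeff ρ k‖
      ≤ 2 * Real.pi * |(k : ℝ)| * (3 / 2 * (envelopeError C₀ B C c₀ p L e / m)) := by
  intro ρ
  set φ := normalizedPhase θ with hφdef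
  set σ := normalizedPhase ψ with hσdef
  have hNR : (1 : ℝ) ≤ N := by exact_mod_cast hN1
  have hLR : (0 : ℝ) < L := by exact_mod_cast hL1
  have hLp : 0 < numPeriods θ := by rw [hL]; exact hLR
  have hNp : 1 ≤ numPeriods ψ := by rw [hN]; exact hNR
  have hσ : IsUnitCoordinate σ := hψ.isUnitCoordinate (by linarith) hψpos
  have he0 : 0 ≤ e := (abs_nonneg _).trans (he 0)
  have h0mem : (0 : ℝ) ∈ Icc (0 : ℝ) 1 := left_mem_Icc.2 zero_le_one
  have hC0 : 0 ≤ C := (hφ.deriv_pos 0 h0mem).le.trans (hφC 0 h0mem)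
  have hB0 : 0 ≤ B := (abs_nonneg _).trans (hfB 0 h0mem)
  have hφσ : ∀ t ∈ Icc (0 : ℝ) 1, |φ t - σ t| ≤ e := fun t ht =>
    abs_normalizedPhase_sub_le hθ hψ hφ hLp hNp he ht
  have hφσ1 : ∀ t ∈ Icc (0 : ℝ) 1, |deriv φ t - deriv σ t| ≤ (1 + C) * e / N := fun t ht => by
    rw [← hN]
    exact abs_deriv_normalizedPhase_sub_le hθ hψ hLp hNp he
      (by rw [abs_of_pos (hφ.deriv_pos t ht)]; exact hφC t ht)
  have hφσ2 : ∀ t ∈ Icc (0 : ℝ) 1, |deriv φ t - deriv σ t| ≤ (1 + C) * e := fun t ht =>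
    (hφσ1 t ht).trans (div_le_self (by positivity) hNR)
  have hσm : ∀ t ∈ Icc (0 : ℝ) 1, c₀ / 2 ≤ deriv σ t := fun t ht => by
    have h1 := (abs_le.1 ((hφσ1 t ht).trans hsmall)).2
    have h2 := hφc t ht
    linarith
  set D := phaseDeviation θ ψ with hD
  have hDd := hasDerivAt_phaseDeviation hθ.1 hψ.1
  have hDe : ∀ t ∈ Icc (0 : ℝ) 1, |D t| ≤ e := fun t ht => abs_phaseDeviation_le hθ.1 hψ.1 he ht
  have hD0 : D 0 = 0 := by simp [hD, phaseDeviation]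
  -- Integrality of both period counts enters here: `D 1 = 2π(L - N)`, so the modulation is
  -- periodic.
  have hD1 : Complex.exp (Complex.I * (D 1 : ℝ)) = 1 := by
    rw [Complex.exp_eq_one_iff]
    refine ⟨(L : ℤ) - N, ?_⟩
    have : D 1 = (L - N) * (2 * Real.pi) := by
      rw [hD, phaseDeviation, sub_eq_numPeriods, sub_eq_numPeriods, hL, hN]; ring
    rw [this]; push_cast; ring
  have hDc : Continuous D := continuous_iff_continuousAt.2 fun t => (hDd t).continuousAt
  have hD'c : Continuous fun t => deriv θ t - deriv ψ t := hθ.continuous_deriv.sub hψ.continuous_deriv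
  set U : ℝ → ℂ := fun t => Complex.exp (Complex.I * (D t : ℝ)) with hU
  have hUn : ∀ t, ‖U t‖ = 1 := fun t => by rw [hU]; exact Complex.norm_exp_I_mul_ofReal _
  have hUd : ∀ t, HasDerivAt U (U t * (Complex.I * ((deriv θ t - deriv ψ t : ℝ) : ℂ))) t := fun t =>
    ((hDd t).ofReal_comp.const_mul Complex.I).cexp
  have hUc : Continuous U := continuous_iff_continuousAt.2 fun t => (hUd t).continuousAt
  have hU'c : Continuous fun t => U t * (Complex.I * ((deriv θ t - deriv ψ t : ℝ) : ℂ)) :=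
    hUc.mul (continuous_const.mul (Complex.continuous_ofReal.comp hD'c))
  have hU0 : U 0 = 1 := by simp [hU, hD0]
  have hUe : ∀ t ∈ Icc (0 : ℝ) 1, ‖U t - 1‖ ≤ e := fun t ht =>
    Real.norm_exp_I_mul_ofReal_sub_one_le.trans (hDe t ht)
  set c₁ := coordCoeff φ fun t => (f₁ t : ℂ) with hc₁
  set d₀ := coordCoeff φ fun t => (f₀ t : ℂ) with hd₀def
  have hf₁c : ContinuousOn (fun t => (f₁ t : ℂ)) (Icc 0 1) := Complex.continuous_ofReal.comp_continuousOn hf₁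
  have hf₀c : ContinuousOn (fun t => (f₀ t : ℂ)) (Icc 0 1) := Complex.continuous_ofReal.comp_continuousOn hf₀
  have hinv₁ := hφ.eq_trigSeries hf₁c (hd₁.summable_norm hC₀ hp)
  have hinv₀ := hφ.eq_trigSeries hf₀c (hd₀.summable_norm hC₀ hp)
  -- The constant phase `θ 0` is absorbed into the coefficients, leaving their decay unchanged and
  -- keeping `U` close to `1`.
  set ε : ℂ := Complex.exp (Complex.I * (θ 0 : ℝ)) with hε
  have hεn : ‖ε‖ = 1 := Complex.norm_exp_I_mul_ofReal _
  have hd₁' : HasPowerDecay (fun k => ε * c₁ k) C₀ p := fun k hk => by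
    rw [norm_mul, hεn, one_mul]; exact hd₁ k hk
  set u : ℝ → ℂ := fun t => f₁ t * Complex.exp ((θ 0 + D t : ℝ) * Complex.I) with hu
  have huU : ∀ t ∈ Icc (0 : ℝ) 1, u t = trigSeries (fun k => ε * c₁ k) (φ t) * U t := by
    intro t ht
    rw [trigSeries_const_mul, ← hinv₁ t ht, hε, hU]
    simp only [hu, Complex.ofReal_add]
    rw [show ((θ 0 : ℂ) + D t) * Complex.I = Complex.I * θ 0 + Complex.I * D t by ring, Complex.exp_add]
    ring
  have hω : Continuous fun t => Complex.exp ((θ 0 + D t : ℝ) * Complex.I) :=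
    Complex.continuous_exp.comp ((Complex.continuous_ofReal.comp (continuous_const.add hDc)).mul continuous_const)
  have huc : ContinuousOn u (Icc 0 1) := hf₁c.mul hω.continuousOn
  obtain ⟨hus, hut⟩ := hd₁'.coeffTail_comp_mul_le hC₀ hp hσ hφ hUd hU'c hU0 hD1 (B := B) (C₁ := 1 + C)
    he0 (half_pos hc₀) hC0 hB0 (by positivity) hσm hφC hUe
    (fun t ht => by
      rw [trigSeries_const_mul, ← hinv₁ t ht, norm_mul, norm_mul, norm_mul, hεn, hUn, Complex.norm_I,
        one_mul, one_mul, one_mul, Complex.norm_real, Complex.norm_real]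
      exact mul_le_mul (hfB t ht) (he t) (abs_nonneg _) hB0) hφσ hφσ2
  rw [← funext fun k => coordCoeff_congr (σ := σ) huU k] at hus hut
  have hf₀1 : ∀ t ∈ Icc (0 : ℝ) 1, (f₀ t : ℂ) = trigSeries d₀ (φ t) * 1 := fun t ht => by
    rw [mul_one]; exact hinv₀ t ht
  -- For `f₀` only the coordinate changes. The constant `B` is not needed for `U = 1`, but keeping
  -- it gives both tails the same bound.
  obtain ⟨h0s, h0t⟩ := hd₀.coeffTail_comp_mul_le hC₀ hp hσ hφ (U := fun _ => 1) (U' := fun _ => 0)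
    (fun t => hasDerivAt_const t _) continuous_const rfl rfl (B := B) (C₁ := 1 + C)
    he0 (half_pos hc₀) hC0 hB0 (by positivity) hσm hφC (fun t _ => by simpa using he0)
    (fun t _ => by simp only [norm_zero, mul_zero]; positivity) hφσ hφσ2
  rw [← funext fun k => coordCoeff_congr (σ := σ) hf₀1 k] at h0s h0t
  have hK : (L : ℝ) / 4 ≤ (N : ℝ) / 2 := by linarith
  have hL4 : (0 : ℝ) < L / 4 := by positivity
  have hlip : 0 ≤ envelopeLip C₀ B C c₀ * e := mul_nonneg (envelopeLip_nonneg hC₀ hB0 hC0 hc₀) he0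
  have hlipeq : (derivBound C₀ * C + B + derivBound C₀ * C + derivBound C₀ * (1 + C)) * e / (c₀ / 2)
      * invSqrtConst = envelopeLip C₀ B C c₀ * e := by rw [envelopeLip]; ring
  have htail : ∀ T : ℝ, T ≤ C₀ * invSqSum * ((N : ℝ) / 2) ^ (-p + 2)
      + ((N : ℝ) / 2) ^ (-(1 / 4) : ℝ) * (envelopeLip C₀ B C c₀ * e) →
      T ≤ C₀ * invSqSum * ((L : ℝ) / 4) ^ (-p + 2)
      + ((L : ℝ) / 4) ^ (-(1 / 4) : ℝ) * (envelopeLip C₀ B C c₀ * e) := by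
    intro T hT
    refine hT.trans (add_le_add (mul_le_mul_of_nonneg_left ?_ ?_) (mul_le_mul_of_nonneg_right ?_ hlip))
    · exact Real.rpow_le_rpow_of_nonpos hL4 hK (by linarith)
    · exact mul_nonneg hC₀ invSqSum_nonneg
    · exact Real.rpow_le_rpow_of_nonpos hL4 hK (by norm_num)
  have hT1 := htail _ (by simpa only [hlipeq] using hut (N / 2) (by positivity))
  have hT0 := htail _ (by simpa only [hlipeq] using h0t (N / 2) (by positivity))
  set f : ℝ → ℝ := fun s => f₀ s + f₁ s * Real.cos (θ s) with hf
  have hfdec : ∀ t ∈ Icc (0 : ℝ) 1, ((f t : ℝ) : ℂ) = f₀ t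
      + (1 / 2 * (u t * mode N (σ t)) + 1 / 2 * ((starRingEnd ℂ) (u t) * mode (-N) (σ t))) := by
    intro t _
    have h1 : u t * mode N (σ t) = f₁ t * Complex.exp (θ t * Complex.I) := by
      rw [hu, mode_eq_exp_ofReal_mul_I]
      simp only
      rw [mul_assoc, ← Complex.exp_add, ← add_mul, ← Complex.ofReal_add]
      have := mul_normalizedPhase (θ := ψ) (by linarith) t
      rw [hN] at this
      rw [this, hD, phaseDeviation]
      congr 4; ring
    have h2 : (starRingEnd ℂ) (u t) * mode (-N) (σ t) = (starRingEnd ℂ) (u t * mode N (σ t)) := by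
      rw [map_mul _ (u t), conj_mode]
    rw [h2, ← mul_add, Complex.add_conj, h1, Complex.re_ofReal_mul, Complex.exp_ofReal_mul_I_re, hf]
    push_cast; ring
  have hclose : ∀ t ∈ Icc (0 : ℝ) 1, ‖analyticEnvelope σ (fun t => (f t : ℂ)) N t
      - f₁ t * Complex.exp ((θ 0 + D t : ℝ) * Complex.I)‖ ≤ envelopeError C₀ B C c₀ p L e := by
    intro t ht
    refine (hσ.norm_analyticEnvelope_sub_le hf₀c huc hfdec h0s hus t ht).trans ?_
    rw [envelopeError]
    linarith
  obtain ⟨z', hz'c, hz'⟩ := hσ.exists_hasDerivAt_analyticEnvelope (fun t => (f t : ℂ)) N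
  have hA : envelopeA ψ f = fun t => (analyticEnvelope σ (fun t => (f t : ℂ)) N t).re :=
    funext fun t => (envelope_eq (by omega) hN f t).1
  have hB : envelopeB ψ f = fun t => (analyticEnvelope σ (fun t => (f t : ℂ)) N t).im :=
    funext fun t => (envelope_eq (by omega) hN f t).2
  have := norm_timeCoeff_arctanRate_sub_le (ω := fun t => θ 0 + D t) hz' hz'c
    (fun t => (hDd t).const_add _) hD'c hm hfm herr hclose (hσ.analyticEnvelope_zero_eq_one _ _) (by
      rw [Complex.ofReal_add, Complex.ofReal_add, add_mul, add_mul, Complex.exp_add, Complex.exp_add,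
        mul_comm (D 1 : ℂ), hD1, hD0]
      simp)
  rw [← hA, ← hB] at this
  exact this

/-- The difference of frequencies is a trigonometric polynomial, so its `ℓ¹` norm is finite and
dominates its sup norm on the whole line. -/
theorem exists_fourierL1_deriv_sub_eq (hθ : HasFrequencyIn M θ) (hψ : HasFrequencyIn M ψ) :
    ∃ e : ℝ, 0 ≤ e ∧ fourierL1 (deriv fun t => ψ t - θ t) = ENNReal.ofReal e ∧
      ∀ t, |deriv θ t - deriv ψ t| ≤ e := by
  obtain ⟨c, hc⟩ := mem_trigSpace_iff.1 hθ.2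
  obtain ⟨d, hd⟩ := mem_trigSpace_iff.1 hψ.2
  have hdiff : ∀ t, ((deriv ψ t - deriv θ t : ℝ) : ℂ) = trigPoly M (fun k => d k + -c k) t := by
    intro t
    rw [trigPoly_add, Complex.ofReal_sub, hc, hd, sub_eq_add_neg]
    simp [trigPoly]
  refine ⟨_, polyNorm_nonneg M fun k => d k + -c k, ?_, fun t => ?_⟩
  · refine fourierL1_of_eq_trigPoly fun t _ => ?_
    rw [deriv_fun_sub (hψ.1 t) (hθ.1 t)]
    exact hdiff t
  · rw [abs_sub_comm, ← Real.norm_eq_abs, ← Complex.norm_real, hdiff]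
    exact norm_trigPoly_le _ _ _

theorem continuous_trigProj (M : ℕ) (g : ℝ → ℝ) : Continuous (trigProj M g) :=
  Complex.continuous_re.comp (continuous_trigPoly M (timeCoeff g))

theorem polyNorm_le_of_norm_le {c : ℤ → ℂ} {b : ℝ} (hb : 0 ≤ b)
    (hc : ∀ k : ℤ, ‖c k‖ ≤ 2 * Real.pi * |(k : ℝ)| * b) :
    polyNorm M c ≤ (2 * M + 1) * (2 * Real.pi * M * b) := by
  have h1 : ∀ k ∈ Finset.Icc (-(M : ℤ)) (M : ℤ), ‖c k‖ ≤ 2 * Real.pi * M * b := by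
    intro k hk
    refine (hc k).trans ?_
    have : |(k : ℝ)| ≤ M := by
      rw [Finset.mem_Icc] at hk
      exact_mod_cast abs_le.2 hk
    gcongr
  refine (Finset.sum_le_card_nsmul _ _ _ h1).trans_eq ?_
  rw [Int.card_Icc, nsmul_eq_mul]
  congr 1
  have : ((M : ℤ) + 1 - -(M : ℤ)).toNat = 2 * M + 1 := by omega
  rw [this]; push_cast; ring

/-- If the phase update `θ' - ψ' + ρ` is the exact one up to an error `ρ` with small Fourier
coefficients, then one step of the algorithm leaves only the projection of `ρ`. -/
theorem phaseStep_spec {f ρ : ℝ → ℝ} {L : ℕ} {b : ℝ} (hb : 0 ≤ b)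
    (hθ : HasFrequencyIn M θ) (hψ : HasFrequencyIn M ψ) (hL : numPeriods θ = L)
    (hρ : ∀ t, ρ t = arctanRate (envelopeA ψ f) (envelopeB ψ f) t - (deriv θ t - deriv ψ t))
    (hρc : ContinuousOn ρ (Icc 0 1)) (hρb : ∀ k : ℤ, ‖timeCoeff ρ k‖ ≤ 2 * Real.pi * |(k : ℝ)| * b)
    (hbig : ∀ t ∈ Icc (0 : ℝ) 1, (2 * M + 1) * (2 * Real.pi * M * b) ≤ deriv θ t) :
    HasFrequencyIn M (phaseStep M f ψ) ∧ numPeriods (phaseStep M f ψ) = L ∧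
      fourierL1 (deriv fun t => phaseStep M f ψ t - θ t)
        ≤ ENNReal.ofReal ((2 * M + 1) * (2 * Real.pi * M * b)) := by
  obtain ⟨c, hc⟩ := mem_trigSpace_iff.1 hθ.2
  obtain ⟨d, hd⟩ := mem_trigSpace_iff.1 hψ.2
  have hdiff : ∀ t, ((deriv θ t - deriv ψ t : ℝ) : ℂ) = trigPoly M (fun k => c k + -d k) t := by
    intro t
    rw [trigPoly_add, Complex.ofReal_sub, hc, hd, sub_eq_add_neg]
    simp [trigPoly]
  have hinc : ∀ t, freqIncrement M f ψ t = (deriv θ t - deriv ψ t) + trigProj M ρ t := by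
    intro t
    rw [freqIncrement, ← trigProj_add_of_eq_trigPoly hdiff hρc]
    exact trigProj_congr (fun s _ => by rw [hρ]; ring) t
  have hnorm := polyNorm_le_of_norm_le (M := M) hb hρb
  have hproj : ∀ t, |trigProj M ρ t| ≤ (2 * M + 1) * (2 * Real.pi * M * b) := by
    intro t
    rw [← Real.norm_eq_abs, ← Complex.norm_real, ofReal_trigProj]
    exact (norm_trigPoly_le _ _ _).trans hnorm
  -- At `α = 1` the new frequency is `θ'` plus the projected error, nonnegative by `hbig`.
  have hstep : stepLength M f ψ = 1 := by
    refine IsGreatest.csSup_eq ⟨⟨⟨zero_le_one, le_rfl⟩, fun t ht => ?_⟩, fun α hα => hα.1.2⟩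
    have h1 := (abs_le.1 (hproj t)).1
    have h2 := hbig t ht
    rw [hinc]; linarith
  have hincc : Continuous (freqIncrement M f ψ) := continuous_trigProj _ _
  have hder : ∀ t, HasDerivAt (phaseStep M f ψ) (deriv θ t + trigProj M ρ t) t := by
    intro t
    have h1 := (hψ.1 t).hasDerivAt.add
      ((intervalIntegral.integral_hasDerivAt_right (hincc.intervalIntegrable 0 t)
        (hincc.stronglyMeasurableAtFilter _ _) hincc.continuousAt).const_mul (stepLength M f ψ))
    refine h1.congr_deriv ?_
    rw [hstep, hinc]; ring
  have hdiffstep : ∀ t, deriv (fun t => phaseStep M f ψ t - θ t) t = trigProj M ρ t := by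
    intro t
    rw [((hder t).fun_sub (hθ.1 t).hasDerivAt).deriv, add_sub_cancel_left]
  refine ⟨⟨fun t => (hder t).differentiableAt, mem_trigSpace_iff.2 ⟨fun k => c k + timeCoeff ρ k, fun t => ?_⟩⟩,
    ?_, ?_⟩
  · rw [(hder t).deriv, trigPoly_add, ← hc, ← ofReal_trigProj, Complex.ofReal_add]
  -- The bound on the coefficients carries the factor `|k|`, so the error has mean zero and the new
  -- phase has exactly `L` periods.
  · have h0 : timeCoeff ρ 0 = 0 := by simpa using hρb 0
    have h1 : timeCoeff (trigProj M ρ) 0 = 0 := by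
      rw [timeCoeff_of_eq_trigPoly (fun t _ => ofReal_trigProj M ρ t), h0, ite_self]
    have h2 : ∫ t in (0 : ℝ)..1, trigProj M ρ t = 0 := by
      rw [timeCoeff] at h1
      simp only [neg_zero, mode_zero_left, mul_one] at h1
      rw [intervalIntegral.integral_ofReal] at h1
      exact_mod_cast h1
    have h3 := intervalIntegral.integral_eq_sub_of_hasDerivAt (a := 0) (b := 1)
      (fun t _ => (hder t).sub (hθ.1 t).hasDerivAt)
      (by simp only [add_sub_cancel_left]; exact (continuous_trigProj M ρ).intervalIntegrable _ _)
    simp only [add_sub_cancel_left, h2, Pi.sub_apply] at h3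
    rw [← hL, numPeriods, numPeriods]
    congr 1
    linarith
  · refine (fourierL1_of_eq_trigPoly fun t _ => ?_).trans_le (ENNReal.ofReal_le_ofReal hnorm)
    rw [hdiffstep, ofReal_trigProj]

/-! ### Choice of the constants -/

theorem eventually_mul_rpow_le (a : ℝ) {b : ℝ} (hb : 0 < b) :
    ∀ᶠ x : ℝ in Filter.atTop, a * (x / 4) ^ (-(1 / 4) : ℝ) ≤ b := by
  have h1 : Filter.Tendsto (fun x : ℝ => x / 4) Filter.atTop Filter.atTop :=
    Filter.tendsto_id.atTop_div_const (by norm_num)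
  have h2 := ((tendsto_rpow_neg_atTop (y := 1 / 4) (by norm_num)).comp h1).const_mul a
  rw [mul_zero] at h2
  exact h2.eventually_le_const hb

theorem envelopeError_eq (C₀ B C c₀ p L e : ℝ) :
    envelopeError C₀ B C c₀ p L e = 4 * (C₀ * invSqSum) * (L / 4) ^ (-p + 2)
      + 4 * envelopeLip C₀ B C c₀ * (L / 4) ^ (-(1 / 4) : ℝ) * e := by
  rw [envelopeError]; ring

theorem envelopeError_nonneg {C₀ B C c₀ p L e : ℝ} (hC₀ : 0 ≤ C₀) (hB : 0 ≤ B) (hC : 0 ≤ C)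
    (hc₀ : 0 < c₀) (hL : 0 ≤ L) (he : 0 ≤ e) : 0 ≤ envelopeError C₀ B C c₀ p L e := by
  have := envelopeLip_nonneg hC₀ hB hC hc₀
  have := invSqSum_nonneg
  unfold envelopeError; positivity

/-- A crude bound, uniform over `e ≤ E`, for the smallness conditions on `L`; the contraction itself
uses `envelopeError_eq`, which keeps the dependence on `e`. -/
theorem envelopeError_le {C₀ B C c₀ p L e E : ℝ} (hC₀ : 0 ≤ C₀) (hp : 4 ≤ p) (hB : 0 ≤ B) (hC : 0 ≤ C)
    (hc₀ : 0 < c₀) (hL : 4 ≤ L) (heE : e ≤ E) :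
    envelopeError C₀ B C c₀ p L e
      ≤ 4 * (C₀ * invSqSum + envelopeLip C₀ B C c₀ * E) * (L / 4) ^ (-(1 / 4) : ℝ) := by
  have h1 := envelopeLip_nonneg hC₀ hB hC hc₀
  have h2 := invSqSum_nonneg
  have h3 : (L / 4) ^ (-p + 2) ≤ (L / 4) ^ (-(1 / 4) : ℝ) :=
    Real.rpow_le_rpow_of_exponent_le (by linarith) (by linarith)
  calc envelopeError C₀ B C c₀ p L e
      ≤ 4 * (C₀ * invSqSum * (L / 4) ^ (-(1 / 4) : ℝ)
        + (L / 4) ^ (-(1 / 4) : ℝ) * (envelopeLip C₀ B C c₀ * E)) := by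
        unfold envelopeError; gcongr
    _ = _ := by ring

end PhaseRecovery

end

/-! ### Constants, invariants of the iteration, and induction. -/

open PhaseRecovery

theorem mainTheorem2
    (M₀ : ℕ) (C₀ : ℝ) (hC₀ : 0 < C₀) (p : ℝ) (hp : 4 ≤ p)
    (f₁ : ℝ → ℝ) (hf₁c : ContinuousOn f₁ (Set.Icc 0 1)) (hf₁ : ∀ t ∈ Set.Icc (0 : ℝ) 1, 0 < f₁ t) :
    ∃ Γ₀ : ℝ, 0 < Γ₀ ∧ ∀ φ : ℝ → ℝ, ∃ η₀ : ℝ, 4 < η₀ ∧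
      ∀ (θ f₀ θ₀ : ℝ → ℝ) (L : ℕ),
        PhaseRecovery.HasFrequencyIn M₀ θ →
        (∀ t ∈ Set.Icc (0 : ℝ) 1, 0 < deriv θ t) →
        PhaseRecovery.normalizedPhase θ = φ →
        PhaseRecovery.numPeriods θ = (L : ℝ) →
        η₀ < (L : ℝ) →
        ContinuousOn f₀ (Set.Icc 0 1) →
        (∀ k : ℤ, k ≠ 0 → ‖PhaseRecovery.phaseCoeff θ f₀ (k : ℝ)‖ ≤ C₀ * |(k : ℝ)| ^ (-p)) →
        (∀ k : ℤ, k ≠ 0 → ‖PhaseRecovery.phaseCoeff θ f₁ (k : ℝ)‖ ≤ C₀ * |(k : ℝ)| ^ (-p)) →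
        PhaseRecovery.HasFrequencyIn M₀ θ₀ →
        (∃ N : ℤ, PhaseRecovery.numPeriods θ₀ = (N : ℝ)) →
        PhaseRecovery.fourierL1 (deriv (fun t => θ₀ t - θ t))
          ≤ ENNReal.ofReal (Real.pi * (M₀ : ℝ) / 2) →
        ∀ m : ℕ,
          PhaseRecovery.fourierL1 (deriv (fun t =>
              PhaseRecovery.phaseIter M₀ (fun s => f₀ s + f₁ s * Real.cos (θ s)) θ₀ (m + 1) t - θ t))
            ≤ ENNReal.ofReal (Γ₀ * ((L : ℝ) / 4) ^ (-p + 2))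
              + PhaseRecovery.fourierL1 (deriv (fun t =>
                  PhaseRecovery.phaseIter M₀ (fun s => f₀ s + f₁ s * Real.cos (θ s)) θ₀ m t - θ t)) / 2 := by
  have h0mem : (0 : ℝ) ∈ Set.Icc (0 : ℝ) 1 := Set.left_mem_Icc.2 zero_le_one
  obtain ⟨tm, htm, hmin⟩ := isCompact_Icc.exists_isMinOn ⟨0, h0mem⟩ hf₁c
  obtain ⟨B, hB⟩ := isCompact_Icc.exists_bound_of_continuousOn hf₁c
  have hB0 : 0 ≤ B := (norm_nonneg _).trans (hB 0 h0mem)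
  have hm := hf₁ tm htm
  set μ := f₁ tm with hμ
  have hZ := invSqSum_nonneg
  set κ : ℝ := (2 * M₀ + 1) * (2 * Real.pi * M₀ * (3 / 2 / μ)) with hκ
  have hκ0 : 0 ≤ κ := by positivity
  set E : ℝ := Real.pi * (M₀ : ℝ) / 2 with hE
  have hE0 : 0 ≤ E := by positivity
  -- Only `μ = min f₁` enters here, not `φ`. The `+ 1` ensures positivity, since `κ = 0` when `M₀ =
  -- 0`.
  refine ⟨κ * (4 * (C₀ * invSqSum)) + 1, by positivity, fun φ => ?_⟩
  -- If `φ` is not the normalization of any admissible phase, any `η₀ > 4` works vacuously.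
  by_cases hex : ∃ θ : ℝ → ℝ, HasFrequencyIn M₀ θ ∧ (∀ t ∈ Set.Icc (0 : ℝ) 1, 0 < deriv θ t) ∧
    normalizedPhase θ = φ ∧ 0 < numPeriods θ
  swap
  · refine ⟨5, by norm_num, fun θ _ _ L h1 h2 h3 h4 h5 => (hex ⟨θ, h1, h2, h3, ?_⟩).elim⟩
    rw [h4]; linarith
  have hφ : IsUnitCoordinate φ := by
    obtain ⟨θ, h1, h2, rfl, h4⟩ := hex
    exact h1.isUnitCoordinate h4 h2
  obtain ⟨tc, htc, hcmin⟩ := isCompact_Icc.exists_isMinOn ⟨0, h0mem⟩ hφ.continuous_deriv.continuousOn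
  obtain ⟨tC, htC, hCmax⟩ := isCompact_Icc.exists_isMaxOn ⟨0, h0mem⟩ hφ.continuous_deriv.continuousOn
  have hc₀ := hφ.deriv_pos tc htc
  have hC := (hφ.deriv_pos tC htC).le
  set c₀ := deriv φ tc with hc₀def
  set C := deriv φ tC with hCdef
  have hlip := envelopeLip_nonneg hC₀.le hB0 hC hc₀
  set S₀ : ℝ := 4 * (C₀ * invSqSum + envelopeLip C₀ B C c₀ * E) with hS₀
  -- The six conditions serve, in order: the envelope stays away from zero; the new deviation is at
  -- most `E`; the factor of `e` is at most `1/2`; `θ' ≥ E + 1`; `N ≥ L/2`; `ψ̄' ≥ c₀/2`.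
  have hev : ∀ᶠ x : ℝ in Filter.atTop, S₀ * (x / 4) ^ (-(1 / 4) : ℝ) ≤ μ / 2 ∧
      ((2 * M₀ + 1) * (6 / μ) * S₀) * (x / 4) ^ (-(1 / 4) : ℝ) ≤ 1 ∧
      (κ * (4 * envelopeLip C₀ B C c₀)) * (x / 4) ^ (-(1 / 4) : ℝ) ≤ 1 / 2 ∧
      (E + 1) / (2 * Real.pi * c₀) ≤ x ∧ (M₀ : ℝ) ≤ x ∧ 4 * ((1 + C) * E) / c₀ ≤ x :=
    (eventually_mul_rpow_le _ (by positivity)).and <| (eventually_mul_rpow_le _ one_pos).and <|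
      (eventually_mul_rpow_le _ (by norm_num)).and <| (Filter.eventually_ge_atTop _).and <|
      (Filter.eventually_ge_atTop _).and (Filter.eventually_ge_atTop _)
  obtain ⟨η, hη⟩ := Filter.eventually_atTop.1 hev
  refine ⟨max η 5, lt_max_of_lt_right (by norm_num), ?_⟩
  intro θ f₀ θ₀ L hθ hθpos hθφ hL hLη hf₀ hd₀ hd₁ hθ₀ hN₀ he₀
  obtain ⟨hL1, hL2, hL3, hL4, hL5, hL6⟩ := hη L ((le_max_left _ _).trans hLη.le)
  have hL5' : (5 : ℝ) < L := (le_max_right _ _).trans_lt hLη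
  set f : ℝ → ℝ := fun s => f₀ s + f₁ s * Real.cos (θ s) with hf
  have hpi := Real.pi_gt_three
  have hθbig : ∀ t ∈ Set.Icc (0 : ℝ) 1, E + 1 ≤ deriv θ t := by
    intro t ht
    rw [← mul_deriv_normalizedPhase (θ := θ) (by rw [hL]; linarith) t, hθφ, hL]
    rw [div_le_iff₀ (by positivity)] at hL4
    have h1 : c₀ ≤ deriv φ t := hcmin ht
    calc E + 1 ≤ 2 * Real.pi * L * c₀ := by linarith
      _ ≤ _ := by gcongr
  have hstep : ∀ ψ : ℝ → ℝ, HasFrequencyIn M₀ ψ → (∃ N : ℤ, numPeriods ψ = N) →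
      fourierL1 (deriv fun t => ψ t - θ t) ≤ ENNReal.ofReal E →
      HasFrequencyIn M₀ (phaseStep M₀ f ψ) ∧ (∃ N : ℤ, numPeriods (phaseStep M₀ f ψ) = N) ∧
      fourierL1 (deriv fun t => phaseStep M₀ f ψ t - θ t) ≤ ENNReal.ofReal E ∧
      fourierL1 (deriv fun t => phaseStep M₀ f ψ t - θ t)
        ≤ ENNReal.ofReal ((κ * (4 * (C₀ * invSqSum)) + 1) * ((L : ℝ) / 4) ^ (-p + 2))
          + fourierL1 (deriv fun t => ψ t - θ t) / 2 := by
    rintro ψ hψ ⟨N, hN⟩ hψe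
    obtain ⟨e, he0, hefour, he⟩ := exists_fourierL1_deriv_sub_eq hθ hψ
    have heE : e ≤ E := by rwa [hefour, ENNReal.ofReal_le_ofReal_iff hE0] at hψe
    -- The deviation at `t = 1` is `2π(L - N) ≤ E ≤ πL/2`, so in fact `N ≥ 3L/4`.
    have hNL : (L : ℝ) / 2 ≤ N := by
      have h1 := abs_phaseDeviation_le hθ.1 hψ.1 he (t := 1) (Set.right_mem_Icc.2 zero_le_one)
      rw [phaseDeviation, sub_eq_numPeriods, sub_eq_numPeriods, hL, hN] at h1
      have h2 : 2 * Real.pi * (L - N : ℝ) ≤ Real.pi * (L / 2) := by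
        have := (abs_le.1 h1).2
        have h3 : E ≤ Real.pi * L / 2 := by rw [hE]; gcongr
        linarith
      have h4 : 0 ≤ Real.pi * (2 * N - 3 / 2 * L : ℝ) := by linarith
      have := nonneg_of_mul_nonneg_right h4 Real.pi_pos
      linarith
    have hN1 : 1 ≤ N := by
      have : (0 : ℝ) < N := by linarith
      have : 0 < N := by exact_mod_cast this
      omega
    have hψpos : ∀ t ∈ Set.Icc (0 : ℝ) 1, 0 < deriv ψ t := fun t ht => by
      have h1 := hθbig t ht
      have h2 := (abs_le.1 (he t)).2
      linarith
    have hsmall : (1 + C) * e / N ≤ c₀ / 2 := by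
      have hNpos : (0 : ℝ) < N := by linarith
      rw [div_le_iff₀ hc₀] at hL6
      rw [div_le_iff₀ hNpos]
      have h1 : (1 + C) * e ≤ (1 + C) * E := by gcongr
      have h2 : L / 2 * c₀ ≤ N * c₀ := by gcongr
      linarith
    have herrS := envelopeError_le (p := p) hC₀.le hp hB0 hC hc₀ (by linarith : (4 : ℝ) ≤ L) heE
    rw [← hS₀] at herrS
    have herr0 := envelopeError_nonneg (p := p) hC₀.le hB0 hC hc₀ (by linarith : (0 : ℝ) ≤ L) he0
    have herreq := envelopeError_eq C₀ B C c₀ p L e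
    obtain ⟨hρc, hρb⟩ := norm_timeCoeff_arctanRate_envelope_le (θ := θ) (ψ := ψ) (L := L) (N := N)
      (m := μ) (B := B) (C := C) (c₀ := c₀) (e := e) hC₀.le hp hf₁c hf₀ hm (fun t ht => hmin ht) hB hθ
      (by rwa [hθφ]) hL (by exact_mod_cast (by linarith : (0 : ℝ) < L)) hc₀
      (fun t ht => by rw [hθφ]; exact hcmin ht) (fun t ht => by rw [hθφ]; exact hCmax ht)
      (fun k hk => by rw [← phaseCoeff_intCast]; exact hd₀ k hk)
      (fun k hk => by rw [← phaseCoeff_intCast]; exact hd₁ k hk)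
      hψ hN hN1 hNL hψpos he hsmall (herrS.trans hL1)
    set S := envelopeError C₀ B C c₀ p L e with hS
    -- Factoring out `E = πM₀/2` leaves the constant `6 / μ` and covers `M₀ = 0` without division.
    have hbE : (2 * M₀ + 1) * (2 * Real.pi * M₀ * (3 / 2 * (S / μ))) ≤ E := by
      have h1 : (2 * M₀ + 1) * (6 / μ) * S ≤ 1 := by
        refine le_trans ?_ hL2
        rw [mul_assoc _ S₀]
        gcongr
      calc (2 * M₀ + 1) * (2 * Real.pi * M₀ * (3 / 2 * (S / μ)))
          = E * ((2 * M₀ + 1) * (6 / μ) * S) := by rw [hE]; ring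
        _ ≤ E * 1 := by gcongr
        _ = E := mul_one E
    obtain ⟨s1, s2, s3⟩ := phaseStep_spec (f := f) (by positivity) hθ hψ hL (fun t => rfl) hρc hρb
      (fun t ht => hbE.trans (by linarith [hθbig t ht]))
    refine ⟨s1, ⟨L, by rw [s2]; simp⟩, s3.trans (ENNReal.ofReal_le_ofReal hbE), s3.trans ?_⟩
    have hx : (0 : ℝ) ≤ (L / 4 : ℝ) ^ (-p + 2) := by positivity
    rw [hefour, show (2 : ℝ≥0∞) = ENNReal.ofReal 2 by simp, ← ENNReal.ofReal_div_of_pos two_pos,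
      ← ENNReal.ofReal_add (by positivity) (by positivity)]
    refine ENNReal.ofReal_le_ofReal ?_
    calc (2 * M₀ + 1) * (2 * Real.pi * M₀ * (3 / 2 * (S / μ)))
        = κ * S := by rw [hκ]; ring
      _ = κ * (4 * (C₀ * invSqSum)) * ((L : ℝ) / 4) ^ (-p + 2)
          + κ * (4 * envelopeLip C₀ B C c₀) * ((L : ℝ) / 4) ^ (-(1 / 4) : ℝ) * e := by
          rw [herreq]; ring
      _ ≤ (κ * (4 * (C₀ * invSqSum)) + 1) * ((L : ℝ) / 4) ^ (-p + 2) + 1 / 2 * e := by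
          gcongr
          linarith
      _ = _ := by ring
  have hiter : ∀ m : ℕ, HasFrequencyIn M₀ (phaseIter M₀ f θ₀ m) ∧
      (∃ N : ℤ, numPeriods (phaseIter M₀ f θ₀ m) = N) ∧
      fourierL1 (deriv fun t => phaseIter M₀ f θ₀ m t - θ t) ≤ ENNReal.ofReal E := by
    intro m
    induction m with
    | zero => exact ⟨hθ₀, hN₀, he₀⟩
    | succ m ih =>
      rw [phaseIter, Function.iterate_succ_apply']
      obtain ⟨h1, h2, h3, -⟩ := hstep _ ih.1 ih.2.1 ih.2.2
      exact ⟨h1, h2, h3⟩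
  intro m
  obtain ⟨h1, h2, h3⟩ := hiter m
  have h4 := (hstep _ h1 h2 h3).2.2.2
  have h5 : phaseIter M₀ f θ₀ (m + 1) = phaseStep M₀ f (phaseIter M₀ f θ₀ m) :=
    Function.iterate_succ_apply' _ _ _
  rw [h5]
  exact h4
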